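/- Let $\mathcal N_d$ be the standard Gaussian distribution on $\mathbb R^d$, let $\Phi$ be the cumulative distribution function of $\mathcal N_1$, and let $D_{\mathrm{null}}$ be the distribution of $(\mathbf x,y)$ on $\mathbb R^d\times\{\pm1\}$ with $\mathbf x\sim\mathcal N_d$ and $y$ uniform on $\{\pm1\}$ independent of $\mathbf x$. For distributions $D,D_1,D_2$ on $\mathbb R^d\times\{\pm1\}$ with densities with respect to (Lebesgue measure) $\times$ (counting measure), denoted by the same letters, where $D_1$ and $D_2$ are absolutely continuous with respect to $D$, the pairwise correlation is $$\chi_D(D_1,D_2)=\sum_{y\in\{\pm1\}}\int_{\mathbb R^d}\frac{D_1(\mathbf x,y)\,D_2(\mathbf x,y)}{D(\mathbf x,y)}\,d\mathbf x-1 .$$ There are absolute constants $\alpha_0,C,c_1,c_2>0$ and $d_0\in\mathbb N$ such that for every $0<\alpha\le\alpha_0$ and every $d\ge d_0$ there exist a finite set $V$ of unit vectors in $\mathbb R^d$ and a family $\mathcal D=\{D_{\mathbf v}:\mathbf v\in V\}$ of pairwise distinct probability distributions on $\mathbb R^d\times\{\pm1\}$ with $|\mathcal D|=|V|\ge 2^{d^{c_1}}$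 such that: 1. for every $\mathbf v\in V$ and $(\mathbf x,y)\sim D_{\mathbf v}$, the marginal distribution of $\mathbf x$ is $\mathcal N_d$; 2. for every $\mathbf v\in V$, $\mathbb E_{(\mathbf x,y)\sim D_{\mathbf v}}[y\mid\mathbf x=\mathbf x']=1$ for all $\mathbf x'\in\mathbb R^d$ with $\langle\mathbf v,\mathbf x'\rangle\ge\Phi^{-1}(1-\alpha)$ (that is, some version of the regression function $\mathbf x'\mapsto\mathbb E[y\mid\mathbf x=\mathbf x']$ equals $1$ at all these points); 3. for all $\mathbf u,\mathbf v\in V$ the pairwise correlation $\chi_{D_{\mathrm{null}}}(D_{\mathbf u},D_{\mathbf v})$ is well defined and finite, with $$|\chi_{D_{\mathrm{null}}}(D_{\mathbf u},D_{\mathbf v})|\le C\ \text{ if }\mathbf u=\mathbf v,\qquad |\chi_{D_{\mathrm{null}}}(D_{\mathbf u},D_{\mathbf v})|\le d^{-c_2\log(1/\alpha)}\ \text{ if }\mathbf u\ne\mathbf v .$$ -/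

import Mathlib

open MeasureTheory ProbabilityTheory
open scoped ENNReal

noncomputable section

namespace ReliableHalfspace

/-- `ℝ^d` with the Euclidean norm and inner product. -/
abbrev Space (d : ℕ) : Type := EuclideanSpace ℝ (Fin d)

/-- Labelled examples `(x, y) ∈ ℝ^d × {±1}`; the label set `{±1}` is the unit group of `ℤ`. -/
abbrev Example (d : ℕ) : Type := Space d × ℤˣ

/-- The cumulative distribution function `Φ` of the standard normal distribution on `ℝ`. -/
def stdNormalCDF (t : ℝ) : ℝ := cdf (gaussianReal 0 1) t

/-- The quantile function `Φ⁻¹` of the standard normal distribution. On `(0, 1)` it is the inverse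
of the continuous, strictly increasing function `Φ`. -/
def stdNormalQuantile (p : ℝ) : ℝ := sInf {t : ℝ | p ≤ stdNormalCDF t}

/-- The reference measure on `ℝ^d × {±1}` with respect to which densities are taken:
Lebesgue measure times counting measure. -/
def refMeasure (d : ℕ) : Measure (Example d) :=
  (volume : Measure (Space d)).prod Measure.count

/-- The uniform distribution on `{±1}`. -/
def uniformSign : Measure ℤˣ :=
  (2⁻¹ : ℝ≥0∞) • Measure.dirac 1 + (2⁻¹ : ℝ≥0∞) • Measure.dirac (-1)

/-- The null distribution: `x` is standard Gaussian and `y` is a uniform sign independent of `x`. -/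
def nullDistribution (d : ℕ) : Measure (Example d) :=
  (stdGaussian (Space d)).prod uniformSign

/-- The density of a distribution on `ℝ^d × {±1}`. -/
def density {d : ℕ} (D : Measure (Example d)) (p : Example d) : ℝ :=
  (D.rnDeriv (refMeasure d) p).toReal

/-- The integrand `D₁ D₂ / D` (in terms of densities) of the pairwise correlation. -/
def correlationIntegrand {d : ℕ} (D D₁ D₂ : Measure (Example d)) (p : Example d) : ℝ :=
  density D₁ p * density D₂ p / density D p

/-- The pairwise correlation of `D₁` and `D₂` relative to `D` makes sense: all three have densities,
`D₁` and `D₂` live where `D` does, and the defining integral converges absolutely. -/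
structure CorrelationDefined {d : ℕ} (D D₁ D₂ : Measure (Example d)) : Prop where
  hasDensity : D ≪ refMeasure d
  hasDensity₁ : D₁ ≪ refMeasure d
  hasDensity₂ : D₂ ≪ refMeasure d
  dominated₁ : D₁ ≪ D
  dominated₂ : D₂ ≪ D
  integrable : Integrable (correlationIntegrand D D₁ D₂) (refMeasure d)

/-- The pairwise correlation `χ_D(D₁, D₂) = ∫ D₁ D₂ / D - 1`. -/
def pairwiseCorrelation {d : ℕ} (D D₁ D₂ : Measure (Example d)) : ℝ :=
  (∫ p, correlationIntegrand D D₁ D₂ p ∂(refMeasure d)) - 1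

/-- `f` is a version of the regression function `x' ↦ E_{(x,y) ∼ D}[y | x = x']`. -/
structure IsRegressionFunction {d : ℕ} (D : Measure (Example d)) (f : Space d → ℝ) : Prop where
  measurable : Measurable f
  ae_eq : (fun p : Example d => f p.1) =ᵐ[D]
    D[fun p : Example d => ((p.2 : ℤ) : ℝ) | MeasurableSpace.comap Prod.fst inferInstance]

end ReliableHalfspace

end

namespace ReliableHalfspace

/-! Each `D v` has standard Gaussian `x` and regression function `g ⟨v, x⟩`, for one function `g : ℝ
→ [-1, 1]` that equals 1 beyond `T = Φ⁻¹(1 - α)` and whose Gaussian moments of order below `k ≈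
log(1/α)/12` vanish. The correlation of `D u` and `D v` is then the Gaussian integral of `g ⟨u, x⟩ *
g ⟨v, x⟩`, at most 1 in absolute value.

Put `ρ = ⟨u, v⟩` and `σ² = 1 - ρ²`. That integral equals `E[g(X) G(ρX)]`, where `G(s) = E[g(s +
σZ)]`. The Gaussian average `G` extends to an entire function with controlled growth in imaginary
directions. The vanishing moments remove its Taylor polynomial of degree below `k`, and Cauchy
estimates bound the remainder, giving `(72|ρ|/σ)^k` (`abs_integral_mul_gaussian_average_le`). This
replaces a Hermite expansion.

To build `g` (`exists_bounded_orthogonal`), add to the indicator of `[T, ∞)` a compensator supported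
on the negative axis: a combination of Chebyshev polynomials `U_j` times the semicircle weight,
divided by the Gaussian density. The tail mass is at most `α`, so the compensator stays within `[-1,
1]` as long as `e^{6k} √α ≤ 1`.

The directions come from a Reed–Solomon code: polynomials of degree below `m` over a field with `q ≈
√d` elements, `m ≈ √q`, agree pairwise in few places, so inner products are `O(d^{-1/4})`. -/

/-! ### Gaussian averages as entire functions -/

/-- Cauchy estimates and a geometric tail settle `‖s‖ ≤ r/2`. For larger `s` the factor `(2‖s‖/r)^k`
is at least 1 and absorbs `F s` and each Taylor term separately. Since `s` is not confined to the
disc, the bound can be integrated over the whole line. -/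
theorem norm_sub_taylor_le_of_entire {F : ℂ → ℂ} (hF : Differentiable ℂ F) {r M : ℝ} (hr : 0 < r)
    (hM : ∀ z ∈ Metric.sphere (0 : ℂ) r, ‖F z‖ ≤ M) (k : ℕ) {s : ℂ} (hs : ‖F s‖ ≤ M) :
    ‖F s - ∑ n ∈ Finset.range k, (n.factorial : ℂ)⁻¹ * iteratedDeriv n F 0 * s ^ n‖ ≤
      (k + 2) * M * (2 * ‖s‖ / r) ^ k := by
  have hM0 : 0 ≤ M := (norm_nonneg _).trans hs
  set a : ℕ → ℂ := fun n => (n.factorial : ℂ)⁻¹ * iteratedDeriv n F 0 * s ^ n with ha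
  have hle : ∀ n, ‖a n‖ ≤ M * (‖s‖ / r) ^ n := by
    intro n
    have h := Complex.norm_iteratedDeriv_le_of_forall_mem_sphere_norm_le n hr hF.diffContOnCl hM
    have hn : (0 : ℝ) < n.factorial := by positivity
    simp only [ha, norm_mul, norm_inv, norm_pow, Complex.norm_natCast]
    calc (n.factorial : ℝ)⁻¹ * ‖iteratedDeriv n F 0‖ * ‖s‖ ^ n
        ≤ (n.factorial : ℝ)⁻¹ * (n.factorial * M / r ^ n) * ‖s‖ ^ n := by gcongr
      _ = M * (‖s‖ / r) ^ n := by rw [div_pow]; field_simp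
  have hsum : HasSum a (F s) := by
    have h := Complex.hasSum_taylorSeries_of_entire hF 0 s
    refine (funext fun n => ?_ : a = _) ▸ h
    simp only [ha, sub_zero, smul_eq_mul]; ring
  set q := ‖s‖ / r with hq
  have hq0 : 0 ≤ q := by positivity
  have h2q : 2 * ‖s‖ / r = 2 * q := by rw [hq]; ring
  rw [h2q]
  rcases le_total q (1 / 2) with hq2 | hq2
  · have h1 : HasSum (fun n => a (n + k)) (F s - ∑ n ∈ Finset.range k, a n) :=
      (hasSum_nat_add_iff' k).2 hsum
    have h2 : HasSum (fun n => M * q ^ k * q ^ n) (M * q ^ k * (1 - q)⁻¹) :=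
      (hasSum_geometric_of_lt_one hq0 (by linarith)).mul_left _
    have h3 := tsum_of_norm_bounded h2 (f := fun n => a (n + k))
      (fun n => (hle (n + k)).trans_eq (by ring))
    rw [h1.tsum_eq] at h3
    refine h3.trans ?_
    have h4 : (1 - q)⁻¹ ≤ 2 := by
      rw [inv_le_comm₀ (by linarith) (by norm_num)]; linarith
    calc M * q ^ k * (1 - q)⁻¹ ≤ M * q ^ k * 2 := by gcongr
      _ ≤ M * (2 * q) ^ k * 2 := by gcongr; linarith
      _ = 2 * M * (2 * q) ^ k := by ring
      _ ≤ (k + 2) * M * (2 * q) ^ k := by gcongr; linarith [(k.cast_nonneg : (0 : ℝ) ≤ k)]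
  · have h1 : 1 ≤ (2 * q) ^ k := one_le_pow₀ (by linarith)
    calc ‖F s - ∑ n ∈ Finset.range k, a n‖ ≤ ‖F s‖ + ∑ n ∈ Finset.range k, ‖a n‖ :=
          (norm_sub_le _ _).trans (by gcongr; exact norm_sum_le _ _)
      _ ≤ M * (2 * q) ^ k + ∑ n ∈ Finset.range k, M * (2 * q) ^ k := by
          gcongr with n hn
          · exact hs.trans (le_mul_of_one_le_right hM0 h1)
          · refine (hle n).trans ?_
            gcongr
            calc q ^ n ≤ (2 * q) ^ n := by gcongr; linarith
              _ ≤ (2 * q) ^ k := pow_le_pow_right₀ (by linarith) (Finset.mem_range.1 hn).le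
      _ = (k + 1) * M * (2 * q) ^ k := by simp; ring
      _ ≤ _ := by gcongr; norm_num

theorem integral_gaussianReal_comp_add (f : ℝ → ℝ) (t : ℝ) :
    ∫ z, f (z + t) ∂(gaussianReal 0 1) =
      Real.exp (-t ^ 2 / 2) * ∫ w, Real.exp (t * w) * f w ∂(gaussianReal 0 1) := by
  rw [integral_gaussianReal_eq_integral_smul one_ne_zero,
    integral_gaussianReal_eq_integral_smul one_ne_zero, ← integral_const_mul,
    ← integral_sub_right_eq_self _ t]
  refine integral_congr_ae (Filter.Eventually.of_forall fun w => ?_)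
  simp only [gaussianPDFReal, smul_eq_mul, sub_add_cancel]
  have : Real.exp (-(w - t - 0) ^ 2 / (2 * ((1 : NNReal) : ℝ))) =
      Real.exp (-t ^ 2 / 2) * Real.exp (t * w) * Real.exp (-(w - 0) ^ 2 / (2 * ((1 : NNReal) : ℝ))) := by
    rw [← Real.exp_add, ← Real.exp_add]; congr 1; simp; ring
  rw [this]; ring

/-- Completing the square writes the average as `exp(-(s/σ)²/2)` times the moment generating
function, at `s/σ`, of the Gaussian weighted by `h (σ ·)`. That function is entire and dominated by
the Gaussian one at the real part, so the real-part exponentials cancel. -/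
theorem exists_entire_extension_gaussian_average {h : ℝ → ℝ} (hm : Measurable h)
    (h0 : ∀ x, 0 ≤ h x) (h1 : ∀ x, h x ≤ 1) {σ : ℝ} (hσ : 0 < σ) :
    ∃ F : ℂ → ℂ, Differentiable ℂ F ∧
      (∀ s : ℝ, F s = ((∫ z, h (s + σ * z) ∂(gaussianReal 0 1) : ℝ) : ℂ)) ∧
      ∀ z : ℂ, ‖F z‖ ≤ Real.exp ((z.im / σ) ^ 2 / 2) := by
  set μ : Measure ℝ := (gaussianReal 0 1).withDensity (fun x => ENNReal.ofReal (h (σ * x))) with hμ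
  have hle : μ ≤ gaussianReal 0 1 := by
    refine (withDensity_mono (g := 1) (Filter.Eventually.of_forall fun x => ?_)).trans_eq
      withDensity_one
    simpa using h1 _
  have hint : ∀ t : ℝ, Integrable (fun x => Real.exp (t * id x)) μ := fun t =>
    (integrable_exp_mul_gaussianReal t).mono_measure hle
  have hset : integrableExpSet id μ = Set.univ := by
    ext t; simpa [integrableExpSet] using hint t
  have hmgf : ∀ t, mgf id μ t ≤ Real.exp (t ^ 2 / 2) := by
    intro t
    calc mgf id μ t ≤ mgf id (gaussianReal 0 1) t :=
          integral_mono_measure hle (Filter.Eventually.of_forall fun x => (Real.exp_pos _).le)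
            (integrable_exp_mul_gaussianReal t)
      _ = _ := by rw [mgf_id_gaussianReal]; simp
  have hd : Differentiable ℂ (complexMGF id μ) := fun z =>
    (hasDerivAt_complexMGF (by simp [hset])).differentiableAt
  refine ⟨fun z => Complex.exp (-(z / σ) ^ 2 / 2) * complexMGF id μ (z / σ), ?_, ?_, ?_⟩
  · refine Differentiable.mul (by fun_prop) (hd.comp (by fun_prop))
  · intro s
    have e1 : (s : ℂ) / σ = ((s / σ : ℝ) : ℂ) := by push_cast; rfl
    have e2 : mgf id μ (s / σ) = ∫ w, Real.exp (s / σ * w) * h (σ * w) ∂(gaussianReal 0 1) := by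
      rw [mgf, hμ, integral_withDensity_eq_integral_toReal_smul (by fun_prop) (by simp)]
      refine integral_congr_ae (Filter.Eventually.of_forall fun w => ?_)
      simp [ENNReal.toReal_ofReal (h0 _), mul_comm]
    have e3 := integral_gaussianReal_comp_add (fun w => h (σ * w)) (s / σ)
    have e4 : ∀ z, h (s + σ * z) = h (σ * (z + s / σ)) := fun z => by congr 1; field_simp; ring
    simp_rw [e4]
    rw [e3, ← e2, e1, complexMGF_ofReal]
    push_cast; rfl
  · intro z
    have er : (z / (σ : ℂ)).re = z.re / σ := by simp [Complex.div_ofReal_re]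
    have ei : (z / (σ : ℂ)).im = z.im / σ := by simp [Complex.div_ofReal_im]
    rw [norm_mul, Complex.norm_exp]
    calc _ ≤ Real.exp (-(z / (σ : ℂ)) ^ 2 / 2).re * Real.exp ((z.re / σ) ^ 2 / 2) := by
          gcongr
          exact norm_complexMGF_le_mgf.trans (er ▸ hmgf _)
      _ = _ := by
          rw [← Real.exp_add]; congr 1
          rw [← er, ← ei]
          have : (-(z / (σ : ℂ)) ^ 2 / 2).re =
              -((z / (σ : ℂ)).re ^ 2 - (z / (σ : ℂ)).im ^ 2) / 2 := by
            generalize z / (σ : ℂ) = w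
            simp [pow_two]
          rw [this]; ring

theorem exp_mul_abs_le (a x : ℝ) : Real.exp (a * |x|) ≤ Real.exp (a * x) + Real.exp (-a * x) := by
  rcases abs_cases x with ⟨h, _⟩ | ⟨h, _⟩ <;> rw [h]
  · linarith [Real.exp_pos (-a * x)]
  · rw [mul_neg, ← neg_mul]; linarith [Real.exp_pos (a * x)]

theorem integrable_exp_mul_abs_gaussianReal (a : ℝ) :
    Integrable (fun x => Real.exp (a * |x|)) (gaussianReal 0 1) := by
  refine ((integrable_exp_mul_gaussianReal a).add (integrable_exp_mul_gaussianReal (-a))).mono'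
    (by fun_prop) (Filter.Eventually.of_forall fun x => ?_)
  rw [Real.norm_of_nonneg (Real.exp_pos _).le]
  exact exp_mul_abs_le a x

theorem integral_exp_mul_abs_gaussianReal_le (a : ℝ) :
    ∫ x, Real.exp (a * |x|) ∂(gaussianReal 0 1) ≤ 2 * Real.exp (a ^ 2 / 2) := by
  have h : ∀ t, ∫ x, Real.exp (t * x) ∂(gaussianReal 0 1) = Real.exp (t ^ 2 / 2) := by
    intro t
    have := congrFun (mgf_id_gaussianReal (μ := 0) (v := 1)) t
    simpa [mgf] using this
  calc ∫ x, Real.exp (a * |x|) ∂(gaussianReal 0 1)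
      ≤ ∫ x, (Real.exp (a * x) + Real.exp (-a * x)) ∂(gaussianReal 0 1) :=
        integral_mono (integrable_exp_mul_abs_gaussianReal a)
          ((integrable_exp_mul_gaussianReal a).add (integrable_exp_mul_gaussianReal (-a)))
          (exp_mul_abs_le a)
    _ = _ := by
        rw [integral_add (integrable_exp_mul_gaussianReal a) (integrable_exp_mul_gaussianReal (-a)),
          h, h]
        ring_nf

theorem integrable_abs_pow_gaussianReal (k : ℕ) :
    Integrable (fun x => |x| ^ k) (gaussianReal 0 1) := by
  simpa using (memLp_id_gaussianReal (μ := 0) (v := 1) (k : NNReal)).integrable_norm_pow'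

theorem integral_abs_pow_gaussianReal_le {k : ℕ} (hk : 1 ≤ k) :
    ∫ x, |x| ^ k ∂(gaussianReal 0 1) ≤ √k ^ k * (2 * Real.exp (k / 2)) := by
  have hk0 : (0 : ℝ) < k := by exact_mod_cast hk
  have hs : 0 < √(k : ℝ) := Real.sqrt_pos.2 hk0
  have hss : √(k : ℝ) ^ 2 = k := Real.sq_sqrt hk0.le
  calc ∫ x, |x| ^ k ∂(gaussianReal 0 1)
      ≤ ∫ x, √k ^ k * Real.exp (√k * |x|) ∂(gaussianReal 0 1) := by
        refine integral_mono (integrable_abs_pow_gaussianReal k)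
          ((integrable_exp_mul_abs_gaussianReal _).const_mul _) fun x => ?_
        -- The scale `√k` is the size at which `|x|^k` concentrates under the Gaussian.
        have h1 : |x| / √k ≤ Real.exp (|x| / √k) := by
          linarith [Real.add_one_le_exp (|x| / √k)]
        calc |x| ^ k = √k ^ k * (|x| / √k) ^ k := by rw [← mul_pow]; congr 1; field_simp
          _ ≤ √k ^ k * Real.exp (|x| / √k) ^ k := by gcongr
          _ = √k ^ k * Real.exp (√k * |x|) := by
              have h2 : (k : ℝ) * (|x| / √k) = √k * |x| := by
                calc (k : ℝ) * (|x| / √k) = √k ^ 2 * (|x| / √k) := by rw [hss]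
                  _ = _ := by field_simp
              rw [← Real.exp_nat_mul, h2]
    _ = √k ^ k * ∫ x, Real.exp (√k * |x|) ∂(gaussianReal 0 1) := integral_const_mul _ _
    _ ≤ _ := by
        gcongr
        refine (integral_exp_mul_abs_gaussianReal_le _).trans_eq ?_
        rw [hss]

theorem integrable_mul_pow_gaussianReal {g : ℝ → ℝ} (hm : Measurable g) (hg : ∀ x, |g x| ≤ 1)
    (n : ℕ) : Integrable (fun x => g x * x ^ n) (gaussianReal 0 1) := by
  refine (integrable_abs_pow_gaussianReal n).mono' (by fun_prop)
    (Filter.Eventually.of_forall fun x => ?_)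
  rw [norm_mul, norm_pow, Real.norm_eq_abs, Real.norm_eq_abs]
  exact mul_le_of_le_one_left (by positivity) (hg x)

theorem abs_integral_mul_gaussian_average_le {g : ℝ → ℝ} (hm : Measurable g)
    (hg : ∀ x, |g x| ≤ 1) {k : ℕ} (hk : 1 ≤ k)
    (horth : ∀ n < k, ∫ x, g x * x ^ n ∂(gaussianReal 0 1) = 0) (ρ : ℝ) {σ : ℝ} (hσ : 0 < σ) :
    |∫ x, g x * ∫ z, g (ρ * x + σ * z) ∂(gaussianReal 0 1) ∂(gaussianReal 0 1)| ≤
      (72 * |ρ| / σ) ^ k := by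
  have hk0 : (0 : ℝ) < k := by exact_mod_cast hk
  have hs : 0 < √(k : ℝ) := Real.sqrt_pos.2 hk0
  have hss : √(k : ℝ) ^ 2 = k := Real.sq_sqrt hk0.le
  have hgi : ∀ f : ℝ → ℝ, Measurable f → Integrable (fun z => g (f z)) (gaussianReal 0 1) :=
    fun f hf => Integrable.of_bound (hm.comp hf).aestronglyMeasurable 1 (Filter.Eventually.of_forall fun x => hg _)
  -- A density must be nonnegative, hence `(1 + g)/2` in place of `g`.
  obtain ⟨F, hF, hFs, hFb⟩ := exists_entire_extension_gaussian_average
    (h := fun x => (1 + g x) / 2) (by fun_prop) (fun x => by linarith [(abs_le.1 (hg x)).1])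
    (fun x => by linarith [(abs_le.1 (hg x)).2]) hσ
  have hFg : ∀ s : ℝ, ((∫ z, g (s + σ * z) ∂(gaussianReal 0 1) : ℝ) : ℂ) = 2 * F s - 1 := by
    intro s
    rw [hFs, integral_div, integral_add (by simp) (hgi _ (by fun_prop))]
    simp; ring
  -- With this radius `F` grows only to `e^{k/2}`, and `√k^k` cancels against the `k`-th absolute
  -- moment.
  set r := σ * √k with hr
  have hr0 : 0 < r := by positivity
  set c : ℕ → ℂ := fun n => (n.factorial : ℂ)⁻¹ * iteratedDeriv n F 0 with hc
  have hrem : ∀ s : ℝ, ‖F s - ∑ n ∈ Finset.range k, c n * (s : ℂ) ^ n‖ ≤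
      (k + 2) * Real.exp (k / 2) * (2 * |s| / r) ^ k := by
    intro s
    have := norm_sub_taylor_le_of_entire hF hr0 (M := Real.exp (k / 2)) (fun z hz => ?_) k (s := s) ?_
    · simpa using this
    · refine (hFb z).trans (Real.exp_le_exp.2 ?_)
      have h1 : |z.im| ≤ r := (Complex.abs_im_le_norm z).trans_eq (by simpa using hz)
      have h2 : (z.im / σ) ^ 2 ≤ √k ^ 2 := by
        rw [sq_le_sq, abs_div, abs_of_pos hσ, abs_of_pos hs, div_le_iff₀ hσ, mul_comm]
        exact h1
      rw [hss] at h2; linarith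
    · refine (hFb s).trans (Real.exp_le_exp.2 ?_)
      simp; positivity
  have hF' : Continuous F := hF.continuous
  set A : ℝ → ℂ := fun x => (g x : ℂ) * (2 * F ((ρ * x : ℝ) : ℂ) - 1) with hA
  set B : ℝ → ℂ := fun x => ∑ n ∈ Finset.range k, (2 * c n * (ρ : ℂ) ^ n) * ((g x * x ^ n : ℝ) : ℂ) -
    ((g x * x ^ 0 : ℝ) : ℂ) with hB
  have hgn : ∀ n, Integrable (fun x => ((g x * x ^ n : ℝ) : ℂ)) (gaussianReal 0 1) := fun n =>
    (integrable_mul_pow_gaussianReal hm hg n).ofReal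
  have hAe : ∀ x, A x = ((g x * ∫ z, g (ρ * x + σ * z) ∂(gaussianReal 0 1) : ℝ) : ℂ) := by
    intro x; rw [Complex.ofReal_mul, hFg]
  have hAi : Integrable A (gaussianReal 0 1) := by
    refine Integrable.of_bound (Measurable.aestronglyMeasurable ?_) 1
      (Filter.Eventually.of_forall fun x => ?_)
    · exact (Complex.measurable_ofReal.comp hm).mul
        (Continuous.measurable (by fun_prop))
    · rw [hAe, Complex.norm_real, norm_mul]
      refine mul_le_one₀ (hg x) (norm_nonneg _) ?_
      refine (norm_integral_le_of_norm_le_const (C := 1)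
        (Filter.Eventually.of_forall fun z => hg _)).trans ?_
      simp
  have hBi : Integrable B (gaussianReal 0 1) :=
    (integrable_finsetSum _ fun n _ => (hgn n).const_mul _).sub (hgn 0)
  have hB0 : ∫ x, B x ∂(gaussianReal 0 1) = 0 := by
    have h0 : ∀ n < k, ∫ x, ((g x * x ^ n : ℝ) : ℂ) ∂(gaussianReal 0 1) = 0 := fun n hn => by
      rw [integral_complex_ofReal, horth n hn, Complex.ofReal_zero]
    rw [hB, integral_sub (integrable_finsetSum _ fun n _ => (hgn n).const_mul _) (hgn 0),
      integral_finsetSum _ fun n _ => (hgn n).const_mul _, h0 0 hk, sub_zero]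
    refine Finset.sum_eq_zero fun n hn => ?_
    rw [integral_const_mul, h0 n (Finset.mem_range.1 hn), mul_zero]
  have hAB : ∀ x, ‖A x - B x‖ ≤
      2 * ((k + 2) * Real.exp (k / 2) * (2 * |ρ| / r) ^ k) * |x| ^ k := by
    intro x
    have e : A x - B x = (2 * g x : ℝ) *
        (F ((ρ * x : ℝ) : ℂ) - ∑ n ∈ Finset.range k, c n * ((ρ * x : ℝ) : ℂ) ^ n) := by
      simp only [hA, hB, mul_sub, Finset.mul_sum]
      have : ∀ n, (2 * c n * (ρ : ℂ) ^ n) * ((g x * x ^ n : ℝ) : ℂ) =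
          ((2 * g x : ℝ) : ℂ) * (c n * ((ρ * x : ℝ) : ℂ) ^ n) := fun n => by push_cast; ring
      simp_rw [this]
      push_cast; ring
    rw [e, norm_mul, Complex.norm_real, norm_mul, Real.norm_eq_abs, Real.norm_eq_abs, abs_two]
    calc 2 * |g x| * ‖F ((ρ * x : ℝ) : ℂ) - ∑ n ∈ Finset.range k, c n * ((ρ * x : ℝ) : ℂ) ^ n‖
        ≤ 2 * 1 * ((k + 2) * Real.exp (k / 2) * (2 * |ρ * x| / r) ^ k) := by
          gcongr
          · exact hg x
          · exact hrem _
      _ = _ := by rw [abs_mul, show 2 * (|ρ| * |x|) / r = 2 * |ρ| / r * |x| by ring, mul_pow]; ring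
  have key : ∫ x, A x ∂(gaussianReal 0 1) = ∫ x, (A x - B x) ∂(gaussianReal 0 1) := by
    rw [integral_sub hAi hBi, hB0, sub_zero]
  have hlhs : |∫ x, g x * ∫ z, g (ρ * x + σ * z) ∂(gaussianReal 0 1) ∂(gaussianReal 0 1)| =
      ‖∫ x, A x ∂(gaussianReal 0 1)‖ := by
    simp_rw [hAe]
    rw [integral_complex_ofReal, Complex.norm_real, Real.norm_eq_abs]
  rw [hlhs, key]
  have hexp : Real.exp (k / 2) * Real.exp (k / 2) ≤ 3 ^ k := by
    rw [← Real.exp_add, add_halves, ← mul_one (k : ℝ), Real.exp_nat_mul]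
    gcongr
    exact Real.exp_one_lt_three.le
  have hk2 : (k : ℝ) + 2 ≤ 3 ^ k := by
    have h := one_add_mul_le_pow (a := (2 : ℝ)) (by norm_num) k
    have : (1 : ℝ) ≤ k := by exact_mod_cast hk
    norm_num at h; linarith
  have h4 : (4 : ℝ) ≤ 4 ^ k := le_self_pow₀ (by norm_num) (by omega)
  calc _ ≤ ∫ x, 2 * ((k + 2) * Real.exp (k / 2) * (2 * |ρ| / r) ^ k) * |x| ^ k ∂(gaussianReal 0 1) :=
        norm_integral_le_of_norm_le ((integrable_abs_pow_gaussianReal k).const_mul _)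
          (Filter.Eventually.of_forall hAB)
    _ ≤ 2 * ((k + 2) * Real.exp (k / 2) * (2 * |ρ| / r) ^ k) * (√k ^ k * (2 * Real.exp (k / 2))) := by
        rw [integral_const_mul]
        gcongr
        exact integral_abs_pow_gaussianReal_le hk
    _ = 4 * (k + 2) * (Real.exp (k / 2) * Real.exp (k / 2)) * (2 * |ρ| / r * √k) ^ k := by
        rw [mul_pow]; ring
    _ ≤ 4 ^ k * 3 ^ k * 3 ^ k * (2 * |ρ| / r * √k) ^ k := by gcongr
    _ = _ := by
        rw [← mul_pow, ← mul_pow, ← mul_pow]; congr 1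
        rw [hr]; field_simp; ring

/-! ### Ridge functions under the standard Gaussian -/

theorem map_inner_stdGaussian {d : ℕ} {u : Space d} (hu : ‖u‖ = 1) :
    (stdGaussian (Space d)).map (fun x => inner ℝ u x) = gaussianReal 0 1 := by
  have h := IsGaussian.map_eq_gaussianReal (μ := stdGaussian (Space d)) (innerSL ℝ u)
  rw [integral_strongDual_stdGaussian, variance_dual_stdGaussian, innerSL_apply_norm, hu] at h
  simpa using h

theorem map_inner_prod_stdGaussian {d : ℕ} {u w : Space d} (hu : ‖u‖ = 1) (hw : ‖w‖ = 1)
    (huw : inner ℝ u w = 0) :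
    (stdGaussian (Space d)).map (fun x => ((inner ℝ u x : ℝ), (inner ℝ w x : ℝ))) =
      (gaussianReal 0 1).prod (gaussianReal 0 1) := by
  have hlaw : HasGaussianLaw (fun x : Space d => ((inner ℝ u x : ℝ), (inner ℝ w x : ℝ)))
      (stdGaussian (Space d)) :=
    IsGaussian.hasGaussianLaw_id.map ((innerSL ℝ u).prod (innerSL ℝ w))
  have hcov : cov[fun x => inner ℝ u x, fun x => inner ℝ w x; stdGaussian (Space d)] = 0 := by
    rw [← covarianceBilin_apply_eq_cov IsGaussian.memLp_two_id, covarianceBilin_stdGaussian]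
    exact huw
  have hind := hlaw.indepFun_of_covariance_eq_zero hcov
  rw [(indepFun_iff_map_prod_eq_prod_map_map (by fun_prop) (by fun_prop)).1 hind,
    map_inner_stdGaussian hu, map_inner_stdGaussian hw]

/-- One Gram–Schmidt step: `w = (v - ρu)/σ`. -/
theorem exists_orthogonal_decomposition {d : ℕ} {u v : Space d} (hu : ‖u‖ = 1) (hv : ‖v‖ = 1)
    {σ : ℝ} (hσ : 0 < σ) (hρσ : (inner ℝ u v : ℝ) ^ 2 + σ ^ 2 = 1) :
    ∃ w : Space d, ‖w‖ = 1 ∧ inner ℝ u w = (0 : ℝ) ∧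
      ∀ x : Space d, (inner ℝ v x : ℝ) = inner ℝ u v * inner ℝ u x + σ * inner ℝ w x := by
  set ρ : ℝ := inner ℝ u v with hρ
  set w : Space d := σ⁻¹ • (v - ρ • u) with hw
  have huu : (inner ℝ u u : ℝ) = 1 := by rw [real_inner_self_eq_norm_sq, hu]; norm_num
  have hvv : (inner ℝ v v : ℝ) = 1 := by rw [real_inner_self_eq_norm_sq, hv]; norm_num
  have hvu : (inner ℝ v u : ℝ) = ρ := by rw [real_inner_comm]
  have huw : (inner ℝ u w : ℝ) = 0 := by
    rw [hw, inner_smul_right, inner_sub_right, inner_smul_right, huu, ← hρ]; simp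
  have hww : (inner ℝ w w : ℝ) = 1 := by
    have : (inner ℝ w w : ℝ) = σ⁻¹ * (σ⁻¹ * (1 - ρ ^ 2)) := by
      simp only [hw, inner_smul_right, inner_smul_left, inner_sub_right, inner_sub_left, huu, hvv,
        hvu, ← hρ, conj_trivial]
      ring
    rw [this, show 1 - ρ ^ 2 = σ ^ 2 by linarith]; field_simp
  rw [real_inner_self_eq_norm_sq] at hww
  refine ⟨w, (pow_eq_one_iff_of_nonneg (norm_nonneg w) two_ne_zero).1 hww, huw, fun x => ?_⟩
  rw [hw, real_inner_smul_left, inner_sub_left, real_inner_smul_left]; field_simp; ring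

theorem integral_ridge_mul_ridge {d : ℕ} {u v : Space d} (hu : ‖u‖ = 1) (hv : ‖v‖ = 1)
    {σ : ℝ} (hσ : 0 < σ) (hρσ : (inner ℝ u v : ℝ) ^ 2 + σ ^ 2 = 1) {g : ℝ → ℝ}
    (hm : Measurable g) (hg : ∀ x, |g x| ≤ 1) :
    ∫ x, g (inner ℝ u x) * g (inner ℝ v x) ∂(stdGaussian (Space d)) =
      ∫ x, g x * ∫ z, g (inner ℝ u v * x + σ * z) ∂(gaussianReal 0 1) ∂(gaussianReal 0 1) := by
  obtain ⟨w, hwn, huw, hvx⟩ := exists_orthogonal_decomposition hu hv hσ hρσ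
  set ρ : ℝ := inner ℝ u v with hρ
  have hmeas : Measurable fun p : ℝ × ℝ => g p.1 * g (ρ * p.1 + σ * p.2) := by fun_prop
  have hi : Integrable (fun p : ℝ × ℝ => g p.1 * g (ρ * p.1 + σ * p.2))
      ((gaussianReal 0 1).prod (gaussianReal 0 1)) := by
    refine Integrable.of_bound hmeas.aestronglyMeasurable 1 (Filter.Eventually.of_forall fun p => ?_)
    rw [norm_mul]
    exact mul_le_one₀ (hg _) (norm_nonneg _) (hg _)
  calc _ = ∫ x, (fun p : ℝ × ℝ => g p.1 * g (ρ * p.1 + σ * p.2))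
        ((inner ℝ u x : ℝ), (inner ℝ w x : ℝ)) ∂(stdGaussian (Space d)) := by simp_rw [hvx]
    _ = ∫ p, g p.1 * g (ρ * p.1 + σ * p.2) ∂((gaussianReal 0 1).prod (gaussianReal 0 1)) := by
        rw [← map_inner_prod_stdGaussian hu hwn huw,
          integral_map (by fun_prop) hmeas.aestronglyMeasurable]
    _ = _ := by
        rw [integral_prod _ hi]
        simp_rw [integral_const_mul]

/-- Equality would give `g x = g (ρx + σz)` for almost all `(x, z)`. Since `σ > 0`, a
positive-measure set of `z` lands beyond `T`, so `g = 1` almost everywhere, against mean zero. This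
makes the distributions distinct. -/
theorem not_ridge_ae_eq_ridge {d : ℕ} {u v : Space d} (hu : ‖u‖ = 1) (hv : ‖v‖ = 1)
    (huv : |(inner ℝ u v : ℝ)| < 1) {g : ℝ → ℝ} (hm : Measurable g) {T : ℝ}
    (hT : ∀ x, T ≤ x → g x = 1) (h0 : ∫ x, g x ∂(gaussianReal 0 1) = 0) :
    ¬ (fun x => g (inner ℝ u x)) =ᵐ[stdGaussian (Space d)] fun x => g (inner ℝ v x) := by
  intro hae
  set ρ : ℝ := inner ℝ u v with hρ
  have hρ2 : ρ ^ 2 < 1 := (sq_lt_one_iff_abs_lt_one ρ).2 huv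
  obtain ⟨w, hwn, huw, hvx⟩ := exists_orthogonal_decomposition hu hv (σ := √(1 - ρ ^ 2))
    (Real.sqrt_pos.2 (by linarith)) (by rw [Real.sq_sqrt (by linarith), ← hρ]; ring)
  set σ := √(1 - ρ ^ 2) with hσdef
  have hσ : 0 < σ := Real.sqrt_pos.2 (by linarith)
  have hprod : ∀ᵐ p ∂((gaussianReal 0 1).prod (gaussianReal 0 1)), g p.1 = g (ρ * p.1 + σ * p.2) := by
    rw [← map_inner_prod_stdGaussian hu hwn huw, ae_map_iff (by fun_prop)
      (measurableSet_eq_fun (by fun_prop) (by fun_prop))]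
    filter_upwards [hae] with x hx
    simpa only [hvx] using hx
  have hone : ∀ᵐ x ∂(gaussianReal 0 1), g x = 1 := by
    filter_upwards [Measure.ae_ae_of_ae_prod hprod] with x hx
    have hx' := (gaussianReal_absolutelyContinuous' 0 one_ne_zero).ae_le hx
    have hfreq : ∃ᵐ z ∂(volume : Measure ℝ), z ∈ Set.Ici ((T - ρ * x) / σ) :=
      frequently_ae_mem_iff.2 (by simp)
    obtain ⟨z, hz, hgz⟩ := (hfreq.and_eventually hx').exists
    rw [hgz]
    refine hT _ ?_
    rw [Set.mem_Ici, div_le_iff₀ hσ] at hz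
    linarith
  rw [integral_congr_ae hone] at h0
  simp at h0

theorem abs_integral_ridge_mul_ridge_le {d : ℕ} {u v : Space d} (hu : ‖u‖ = 1) (hv : ‖v‖ = 1)
    (huv : |(inner ℝ u v : ℝ)| ≤ 1 / 2) {g : ℝ → ℝ} (hm : Measurable g) (hg : ∀ x, |g x| ≤ 1)
    {k : ℕ} (hk : 1 ≤ k) (horth : ∀ n < k, ∫ x, g x * x ^ n ∂(gaussianReal 0 1) = 0) :
    |∫ x, g (inner ℝ u x) * g (inner ℝ v x) ∂(stdGaussian (Space d))| ≤
      (144 * |(inner ℝ u v : ℝ)|) ^ k := by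
  set ρ : ℝ := inner ℝ u v with hρ
  have hρ2 : ρ ^ 2 ≤ 1 / 4 := by
    have := pow_le_pow_left₀ (abs_nonneg ρ) huv 2
    rw [sq_abs] at this; linarith
  set σ := √(1 - ρ ^ 2) with hσ
  have hσ2 : σ ^ 2 = 1 - ρ ^ 2 := Real.sq_sqrt (by linarith)
  have hσ1 : 1 / 2 ≤ σ := Real.le_sqrt_of_sq_le (by linarith)
  rw [integral_ridge_mul_ridge hu hv (σ := σ) (by linarith) (by rw [hσ2]; ring) hm hg]
  refine (abs_integral_mul_gaussian_average_le hm hg hk horth ρ (by linarith)).trans ?_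
  gcongr
  rw [div_le_iff₀ (by linarith)]
  nlinarith [abs_nonneg ρ]

/-! ### Chebyshev construction of the threshold function -/

-- With `y = cos θ`, `U_j(y) sin θ = sin((j+1)θ)`. The product of two sines becomes a difference of
-- cosines, that is, of `T` polynomials, integrated against the arcsine weight.
open Polynomial Polynomial.Chebyshev in
theorem integral_U_mul_U (i j : ℕ) :
    ∫ y in (-1 : ℝ)..1, (U ℝ i).eval y * (U ℝ j).eval y * √(1 - y ^ 2) =
      if i = j then Real.pi / 2 else 0 := by
  have h1 : ∫ y in (-1 : ℝ)..1, (U ℝ i).eval y * (U ℝ j).eval y * √(1 - y ^ 2) =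
      ∫ y, (U ℝ i).eval y * (U ℝ j).eval y * (1 - y ^ 2) ∂measureT := by
    rw [integral_measureT]
    refine intervalIntegral.integral_congr fun y hy => ?_
    rw [Set.uIcc_of_le (by norm_num)] at hy
    have h0 : 0 ≤ 1 - y ^ 2 := by nlinarith [hy.1, hy.2]
    have : (1 - y ^ 2) * √(1 - y ^ 2)⁻¹ = √(1 - y ^ 2) := by
      rw [Real.sqrt_inv, ← div_eq_mul_inv, Real.div_sqrt]
    simp only [mul_assoc, this]
  have h2 : ∫ y, (U ℝ i).eval y * (U ℝ j).eval y * (1 - y ^ 2) ∂measureT =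
      ∫ y, ((T ℝ (i - j)).eval y - (T ℝ (i + j + 2)).eval y) / 2 ∂measureT := by
    rw [integral_measureT_eq_integral_cos, integral_measureT_eq_integral_cos]
    refine intervalIntegral.integral_congr fun θ _ => ?_
    have e1 := U_real_cos θ i
    have e2 := U_real_cos θ j
    simp only [T_real_cos]
    have e3 : 1 - Real.cos θ ^ 2 = Real.sin θ * Real.sin θ := by
      rw [← Real.sin_sq]; ring
    rw [e3]
    calc _ = ((U ℝ i).eval (Real.cos θ) * Real.sin θ) * ((U ℝ j).eval (Real.cos θ) * Real.sin θ) := by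
          ring
      _ = _ := by
          rw [e1, e2]
          push_cast
          rw [show ((i : ℝ) - j) * θ = (i + 1) * θ - (j + 1) * θ by ring,
            show ((i : ℝ) + j + 2) * θ = (i + 1) * θ + (j + 1) * θ by ring, Real.cos_sub,
            Real.cos_add]
          ring
  rw [h1, h2, integral_div, integral_sub (integrable_measureT (by fun_prop))
    (integrable_measureT (by fun_prop)),
    integral_eval_T_real_measureT_of_ne_zero (n := i + j + 2) (by positivity), sub_zero]
  split_ifs with h
  · rw [h, sub_self, integral_eval_T_real_measureT_zero]
  · rw [integral_eval_T_real_measureT_of_ne_zero (by omega), zero_div]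

open Polynomial Polynomial.Chebyshev in
theorem abs_U_mul_sqrt_le (j : ℕ) (y : ℝ) : |(U ℝ j).eval y * √(1 - y ^ 2)| ≤ 1 := by
  by_cases hy : 1 - y ^ 2 ≤ 0
  · rw [Real.sqrt_eq_zero_of_nonpos hy]; simp
  · have hy1 : |y| ≤ 1 := (sq_le_one_iff_abs_le_one y).1 (by linarith)
    have hc := Real.cos_arccos (abs_le.1 hy1).1 (abs_le.1 hy1).2
    have h := U_real_cos (Real.arccos y) j
    rw [hc, Real.sin_arccos] at h
    rw [h]
    exact Real.abs_sin_le_one _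

open Polynomial Polynomial.Chebyshev in
theorem U_eval_mem_Icc {y : ℝ} (hy : 1 ≤ y) (j : ℕ) :
    0 ≤ (U ℝ j).eval y ∧ (U ℝ j).eval y ≤ (2 * y) ^ j := by
  -- Monotonicity in `j` is carried along because the recurrence contains a subtraction.
  have key : ∀ j : ℕ, 0 ≤ (U ℝ j).eval y ∧ (U ℝ j).eval y ≤ (U ℝ (j + 1 : ℕ)).eval y ∧
      (U ℝ (j + 1 : ℕ)).eval y ≤ 2 * y * (U ℝ j).eval y ∧ (U ℝ j).eval y ≤ (2 * y) ^ j := by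
    intro j
    induction j with
    | zero => simp; linarith
    | succ j ih =>
      obtain ⟨h0, h1, h2, h3⟩ := ih
      have e : (U ℝ (j + 1 + 1 : ℕ)).eval y =
          2 * y * (U ℝ (j + 1 : ℕ)).eval y - (U ℝ j).eval y := by
        push_cast
        rw [show (j : ℤ) + 1 + 1 = j + 2 by ring, U_add_two]
        simp
      refine ⟨h0.trans h1, by rw [e]; nlinarith, by rw [e]; linarith, ?_⟩
      rw [pow_succ]
      nlinarith
  exact ⟨(key j).1, (key j).2.2.2⟩

theorem integrable_mul_eval_gaussianReal {g : ℝ → ℝ} (hm : Measurable g) (hg : ∀ x, |g x| ≤ 1)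
    (P : Polynomial ℝ) : Integrable (fun x => g x * P.eval x) (gaussianReal 0 1) := by
  simp_rw [Polynomial.eval_eq_sum_range, Finset.mul_sum]
  refine integrable_finsetSum _ fun n _ => ?_
  refine ((integrable_mul_pow_gaussianReal hm hg n).const_mul (P.coeff n)).congr
    (Filter.Eventually.of_forall fun x => by ring)

open Polynomial Polynomial.Chebyshev in
theorem integral_mul_pow_eq_zero_of_U {g : ℝ → ℝ} (hm : Measurable g) (hg : ∀ x, |g x| ≤ 1)
    {R : ℝ} (hR : 0 < R) {k : ℕ}
    (h : ∀ j < k, ∫ x, g x * (U ℝ j).eval (x / R + 1) ∂(gaussianReal 0 1) = 0) :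
    ∀ n < k, ∫ x, g x * x ^ n ∂(gaussianReal 0 1) = 0 := by
  have hint : ∀ P : Polynomial ℝ,
      Integrable (fun x => g x * P.eval (x / R + 1)) (gaussianReal 0 1) := fun P => by
    refine (integrable_mul_eval_gaussianReal hm hg (P.comp (C R⁻¹ * X + 1))).congr
      (Filter.Eventually.of_forall fun x => ?_)
    simp [div_eq_inv_mul]
  -- The recurrence `2y U_{j+1} = U_{j+2} + U_j` trades one power of `y` for a shift of the index,
  -- never raising `n + j`.
  have key : ∀ n j : ℕ, n + j < k →
      ∫ x, g x * ((X ^ n * U ℝ j).eval (x / R + 1)) ∂(gaussianReal 0 1) = 0 := by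
    intro n
    induction n with
    | zero => intro j hj; simpa using h j (by omega)
    | succ n ih =>
      intro j hj
      rcases j with _ | j
      · have e : ∀ x, g x * ((X ^ (n + 1) * U ℝ (0 : ℕ)).eval (x / R + 1)) =
            1 / 2 * (g x * ((X ^ n * U ℝ (1 : ℕ)).eval (x / R + 1))) := fun x => by
          simp; ring
        simp_rw [e]
        rw [integral_const_mul, ih 1 (by omega), mul_zero]
      · have e : ∀ x, g x * ((X ^ (n + 1) * U ℝ (j + 1 : ℕ)).eval (x / R + 1)) =
            1 / 2 * (g x * ((X ^ n * U ℝ (j + 2 : ℕ)).eval (x / R + 1)) +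
              g x * ((X ^ n * U ℝ (j : ℕ)).eval (x / R + 1))) := fun x => by
          have := U_add_two ℝ (j : ℤ)
          push_cast
          rw [this]
          simp; ring
        simp_rw [e]
        rw [integral_const_mul, integral_add (hint _) (hint _), ih (j + 2) (by omega),
          ih j (by omega), add_zero, mul_zero]
  have hy : ∀ n < k, ∫ x, g x * (x / R + 1) ^ n ∂(gaussianReal 0 1) = 0 := fun n hn => by
    simpa using key n 0 (by omega)
  intro n hn
  have e : ∀ x, g x * x ^ n = ∑ m ∈ Finset.range (n + 1),
      (R ^ m * (-R) ^ (n - m) * n.choose m) * (g x * (x / R + 1) ^ m) := fun x => by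
    have hx : x = R * (x / R + 1) + -R := by field_simp; ring
    have hp : x ^ n = (R * (x / R + 1) + -R) ^ n := by rw [← hx]
    rw [hp, add_pow, Finset.mul_sum]
    refine Finset.sum_congr rfl fun m _ => ?_
    rw [mul_pow]; ring
  simp_rw [e]
  rw [integral_finsetSum]
  · refine Finset.sum_eq_zero fun m hm => ?_
    rw [integral_const_mul, hy m (by have := Finset.mem_range.1 hm; omega), mul_zero]
  · intro m _
    refine Integrable.const_mul ?_ _
    simpa using hint (X ^ m)

-- The Gaussian density cancels and an affine change of variable moves the integral to `[-1, 1]`,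
-- where the `U_j` are orthogonal. Each coefficient can thus be prescribed independently.
open Polynomial Polynomial.Chebyshev in
theorem integral_compensator_mul_U {R : ℝ} (hR : 0 < R) (k : ℕ) (c : ℕ → ℝ) {i : ℕ} (hi : i < k) :
    ∫ x, (∑ j ∈ Finset.range k, c j * ((U ℝ j).eval (x / R + 1) * √(1 - (x / R + 1) ^ 2))) /
      gaussianPDFReal 0 1 x * (U ℝ i).eval (x / R + 1) ∂(gaussianReal 0 1) =
      R * (c i * (Real.pi / 2)) := by
  set F : ℝ → ℝ := fun y => (∑ j ∈ Finset.range k, c j * ((U ℝ j).eval y * √(1 - y ^ 2))) *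
    (U ℝ i).eval y with hF
  rw [integral_gaussianReal_eq_integral_smul one_ne_zero]
  have e : ∀ x, gaussianPDFReal 0 1 x • ((∑ j ∈ Finset.range k,
      c j * ((U ℝ j).eval (x / R + 1) * √(1 - (x / R + 1) ^ 2))) /
      gaussianPDFReal 0 1 x * (U ℝ i).eval (x / R + 1)) = F (x / R + 1) := fun x => by
    have := (gaussianPDFReal_pos 0 1 x one_ne_zero).ne'
    simp only [hF, smul_eq_mul]
    rw [← mul_assoc, mul_div_cancel₀ _ this]
  simp_rw [e]
  rw [Measure.integral_comp_div (fun y => F (y + 1)), integral_add_right_eq_self F 1, abs_of_pos hR,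
    smul_eq_mul]
  congr 1
  have hsupp : ∀ y ∉ Set.Ioc (-1 : ℝ) 1, F y = 0 := by
    intro y hy
    have : √(1 - y ^ 2) = 0 := Real.sqrt_eq_zero_of_nonpos (by
      by_contra! h
      have := abs_lt.1 ((sq_lt_one_iff_abs_lt_one y).1 (by linarith))
      exact hy ⟨this.1, this.2.le⟩)
    simp [hF, this]
  rw [← setIntegral_eq_integral_of_forall_compl_eq_zero hsupp,
    ← intervalIntegral.integral_of_le (by norm_num)]
  have e2 : ∀ y, F y = ∑ j ∈ Finset.range k,
      c j * ((U ℝ j).eval y * (U ℝ i).eval y * √(1 - y ^ 2)) := fun y => by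
    simp only [hF, Finset.sum_mul]
    exact Finset.sum_congr rfl fun j _ => by ring
  simp_rw [e2]
  rw [intervalIntegral.integral_finsetSum fun j _ => by
    apply Continuous.intervalIntegrable; fun_prop]
  simp_rw [intervalIntegral.integral_const_mul, integral_U_mul_U]
  simp [hi]

-- On the tail `U_j(x/√k + 1) ≤ 2^k e^{√k x}`. A Cauchy–Schwarz bound against the indicator follows
-- in its AM–GM form.
open Polynomial Polynomial.Chebyshev in
theorem abs_setIntegral_U_le {k j : ℕ} (hk : 1 ≤ k) (hj : j ≤ k) {T β : ℝ} (hT : 0 ≤ T)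
    (hβ : 0 < β) (hTβ : (gaussianReal 0 1).real (Set.Ici T) ≤ β ^ 2) :
    |∫ x in Set.Ici T, (U ℝ j).eval (x / √k + 1) ∂(gaussianReal 0 1)| ≤
      2 ^ k * (Real.exp k * β) := by
  have hk0 : (0 : ℝ) < k := by exact_mod_cast hk
  have hs : 0 < √(k : ℝ) := Real.sqrt_pos.2 hk0
  have hss : √(k : ℝ) ^ 2 = k := Real.sq_sqrt hk0.le
  set γ := gaussianReal 0 1
  -- This weight balances the two AM–GM terms `lam * β²` and `e^{2k} / lam`.
  set lam := Real.exp k / β with hlam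
  have hlam0 : 0 < lam := by positivity
  have hexp : ∫ x, Real.exp (2 * √k * x) ∂γ = Real.exp k ^ 2 := by
    have h := congrFun (mgf_id_gaussianReal (μ := 0) (v := 1)) (2 * √k)
    simp only [mgf, id, mul_pow, hss] at h
    rw [h, ← Real.exp_nat_mul]; congr 1; simp; ring
  have hi := integrable_exp_mul_gaussianReal (μ := 0) (v := 1) (2 * √k)
  have hind : Integrable ((Set.Ici T).indicator (1 : ℝ → ℝ)) γ :=
    (integrable_const (1 : ℝ)).indicator measurableSet_Ici
  rw [← integral_indicator measurableSet_Ici, ← Real.norm_eq_abs]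
  calc _ ≤ ∫ x, 2 ^ k * ((lam * (Set.Ici T).indicator 1 x + Real.exp (2 * √k * x) / lam) / 2) ∂γ := by
        refine norm_integral_le_of_norm_le
          ((((hind.const_mul lam).add (hi.div_const lam)).div_const 2).const_mul _)
          (Filter.Eventually.of_forall fun x => ?_)
        by_cases hx : x ∈ Set.Ici T
        · have hx0 : 0 ≤ x := hT.trans hx
          have hy : 1 ≤ x / √k + 1 := by have : 0 ≤ x / √(k : ℝ) := by positivity
                                         linarith
          have hU := U_eval_mem_Icc hy j
          rw [Set.indicator_of_mem hx, Set.indicator_of_mem hx, Real.norm_of_nonneg hU.1,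
            Pi.one_apply, mul_one]
          have h1 : (x / √k + 1) ^ k ≤ Real.exp (√k * x) := by
            calc (x / √k + 1) ^ k ≤ Real.exp (x / √k) ^ k := by
                  gcongr; exact Real.add_one_le_exp _
              _ = Real.exp (√k * x) := by
                  have : (k : ℝ) * (x / √k) = √k * x := by
                    calc (k : ℝ) * (x / √k) = √k ^ 2 * (x / √k) := by rw [hss]
                      _ = _ := by field_simp
                  rw [← Real.exp_nat_mul, this]
          have h2 : Real.exp (√k * x) ≤ (lam + Real.exp (2 * √k * x) / lam) / 2 := by
            have h3 : Real.exp (2 * √k * x) = Real.exp (√k * x) ^ 2 := by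
              rw [← Real.exp_nat_mul]; congr 1; push_cast; ring
            rw [h3, le_div_iff₀ two_pos, ← sub_nonneg]
            have : lam + Real.exp (√k * x) ^ 2 / lam - Real.exp (√k * x) * 2 =
                (lam - Real.exp (√k * x)) ^ 2 / lam := by field_simp; ring
            rw [this]; positivity
          calc (U ℝ j).eval (x / √k + 1) ≤ (2 * (x / √k + 1)) ^ j := hU.2
            _ ≤ (2 * (x / √k + 1)) ^ k := pow_le_pow_right₀ (by linarith) hj
            _ = 2 ^ k * (x / √k + 1) ^ k := mul_pow _ _ _
            _ ≤ _ := by gcongr; exact h1.trans h2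
        · rw [Set.indicator_of_notMem hx, Set.indicator_of_notMem hx, norm_zero]
          positivity
    _ = 2 ^ k * ((lam * γ.real (Set.Ici T) + Real.exp k ^ 2 / lam) / 2) := by
        rw [integral_const_mul, integral_div, integral_add (hind.const_mul lam) (hi.div_const lam),
          integral_const_mul, integral_div, hexp, integral_indicator_one measurableSet_Ici]
    _ ≤ 2 ^ k * ((lam * β ^ 2 + Real.exp k ^ 2 / lam) / 2) := by gcongr
    _ = _ := by rw [hlam]; field_simp; ring

open Polynomial Polynomial.Chebyshev in
/-- A `[-1, 1]`-valued function equal to `1` beyond `T` whose first `k` Gaussian moments vanish. -/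
theorem exists_bounded_orthogonal {k : ℕ} (hk : 1 ≤ k) {T β : ℝ} (hT : 0 < T)
    (hβ : 0 < β) (hβk : Real.exp (6 * k) * β ≤ 1)
    (hTβ : (gaussianReal 0 1).real (Set.Ici T) ≤ β ^ 2) :
    ∃ g : ℝ → ℝ, Measurable g ∧ (∀ x, |g x| ≤ 1) ∧ (∀ x, T ≤ x → g x = 1) ∧
      ∀ n < k, ∫ x, g x * x ^ n ∂(gaussianReal 0 1) = 0 := by
  have hk0 : (0 : ℝ) < k := by exact_mod_cast hk
  have hk1 : (1 : ℝ) ≤ k := by exact_mod_cast hk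
  have hss : √(k : ℝ) ^ 2 = k := Real.sq_sqrt hk0.le
  set R := √(k : ℝ) with hR
  have hR0 : 0 < R := Real.sqrt_pos.2 hk0
  have hR1 : 1 ≤ R := Real.one_le_sqrt.2 hk1
  -- Solves `R * c j * π/2 = -∫_{[T, ∞)} U_j`, cancelling the moment of the indicator.
  set c : ℕ → ℝ := fun j =>
    -(2 / (Real.pi * R)) * ∫ x in Set.Ici T, (U ℝ j).eval (x / R + 1) ∂(gaussianReal 0 1) with hc
  have hcb : ∀ j ≤ k, |c j| ≤ 2 ^ k * (Real.exp k * β) := by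
    intro j hj
    have h2 : |-(2 / (Real.pi * R))| ≤ 1 := by
      rw [abs_neg, abs_of_pos (by positivity), div_le_one (by positivity)]
      nlinarith [Real.pi_gt_three]
    rw [hc, abs_mul]
    exact (mul_le_of_le_one_left (abs_nonneg _) h2).trans
      (abs_setIntegral_U_le hk hj hT.le hβ hTβ)
  set S : ℝ → ℝ := fun y => ∑ j ∈ Finset.range k, c j * ((U ℝ j).eval y * √(1 - y ^ 2)) with hS
  have hSb : ∀ y, |S y| ≤ k * (2 ^ k * (Real.exp k * β)) := by
    intro y
    refine (Finset.abs_sum_le_sum_abs _ _).trans ?_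
    calc _ ≤ ∑ j ∈ Finset.range k, 2 ^ k * (Real.exp k * β) := by
          refine Finset.sum_le_sum fun j hj => ?_
          rw [abs_mul]
          exact (mul_le_of_le_one_right (abs_nonneg _) (abs_U_mul_sqrt_le j y)).trans
            (hcb j (Finset.mem_range.1 hj).le)
      _ = _ := by simp
  have hS0 : ∀ y, 1 ≤ y ^ 2 → S y = 0 := by
    intro y hy
    simp [hS, Real.sqrt_eq_zero_of_nonpos (show 1 - y ^ 2 ≤ 0 by linarith)]
  -- The shift by 1 puts the support in `[-2R, 0]`, away from `[T, ∞)`.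
  set h : ℝ → ℝ := fun x => S (x / R + 1) / gaussianPDFReal 0 1 x with hh
  have hS_cont : Continuous S := by fun_prop
  have hpdf_meas : Measurable (gaussianPDFReal 0 1) := measurable_gaussianPDFReal 0 1
  have hhm : Measurable h := (hS_cont.measurable.comp (by fun_prop)).div hpdf_meas
  have hh0 : ∀ x, 0 ≤ x → h x = 0 := by
    intro x hx
    have : 0 ≤ x / R := by positivity
    simp [hh, hS0 (x / R + 1) (by nlinarith)]
  have hh1 : ∀ x, |h x| ≤ 1 := by
    intro x
    by_cases hx : 1 ≤ (x / R + 1) ^ 2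
    · simp [hh, hS0 _ hx]
    have hx2 : x ^ 2 ≤ 4 * k := by
      have h1 := abs_lt.1 ((sq_lt_one_iff_abs_lt_one _).1 (not_le.1 hx))
      have h2 : |x / R| ≤ 2 := abs_le.2 ⟨by linarith, by linarith⟩
      have h3 : |x| ≤ 2 * R := by rwa [abs_div, abs_of_pos hR0, div_le_iff₀ hR0] at h2
      have := pow_le_pow_left₀ (abs_nonneg _) h3 2
      rw [sq_abs, mul_pow, hss] at this; linarith
    have hp0 := gaussianPDFReal_pos 0 1 x one_ne_zero
    have hpi : √(2 * Real.pi) ≤ 4 := by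
      rw [Real.sqrt_le_left (by norm_num)]; linarith [Real.pi_lt_four]
    have hpdf : 1 ≤ 4 * Real.exp (2 * k) * gaussianPDFReal 0 1 x := by
      rw [gaussianPDFReal]
      simp only [NNReal.coe_one, mul_one, sub_zero]
      have e1 : Real.exp (-(2 * k)) ≤ Real.exp (-x ^ 2 / 2) := Real.exp_le_exp.2 (by linarith)
      have e2 : Real.exp (2 * k) * Real.exp (-(2 * k)) = 1 := by
        rw [← Real.exp_add, add_neg_cancel, Real.exp_zero]
      have e3 : 4⁻¹ ≤ (√(2 * Real.pi))⁻¹ := inv_anti₀ (by positivity) hpi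
      calc (1 : ℝ) = 4 * Real.exp (2 * k) * (4⁻¹ * Real.exp (-(2 * k))) := by
            linear_combination -e2
        _ ≤ _ := by gcongr
    rw [hh, abs_div, abs_of_pos hp0, div_le_one hp0]
    refine (hSb _).trans ?_
    have hk2 : (k : ℝ) ≤ 2 ^ k := by exact_mod_cast k.lt_two_pow_self.le
    have h4 : (4 : ℝ) ≤ 4 ^ k := le_self_pow₀ (by norm_num) (by omega)
    have h16 : (4 : ℝ) ^ k * 2 ^ k * 2 ^ k ≤ Real.exp (3 * k) := by
      rw [← mul_pow, ← mul_pow, mul_comm (3 : ℝ), Real.exp_nat_mul]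
      gcongr
      have e1 := Real.exp_one_gt_d9
      have e2 : Real.exp 3 = Real.exp 1 ^ 3 := by rw [← Real.exp_nat_mul]; norm_num
      rw [e2]
      calc (4 : ℝ) * 2 * 2 ≤ 2.7 ^ 3 := by norm_num
        _ ≤ _ := by gcongr; linarith
    -- The exponent `6k` is spent as `k` on the coefficients, `2k` on the density lower bound over
    -- the support, and `3k` on `4 * 2^k * k ≤ 16^k`.
    have hb : k * (2 ^ k * (Real.exp k * β)) * (4 * Real.exp (2 * k)) ≤ 1 := by
      calc k * (2 ^ k * (Real.exp k * β)) * (4 * Real.exp (2 * k))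
          = (4 * 2 ^ k * k) * (Real.exp k * Real.exp (2 * k) * β) := by ring
        _ ≤ (4 ^ k * 2 ^ k * 2 ^ k) * (Real.exp k * Real.exp (2 * k) * β) := by gcongr
        _ ≤ Real.exp (3 * k) * (Real.exp k * Real.exp (2 * k) * β) := by gcongr
        _ = Real.exp (6 * k) * β := by
            rw [← Real.exp_add, ← mul_assoc, ← Real.exp_add]; congr 2; ring
        _ ≤ 1 := hβk
    calc k * (2 ^ k * (Real.exp k * β))
        ≤ k * (2 ^ k * (Real.exp k * β)) * (4 * Real.exp (2 * k) * gaussianPDFReal 0 1 x) :=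
          le_mul_of_one_le_right (by positivity) hpdf
      _ = k * (2 ^ k * (Real.exp k * β)) * (4 * Real.exp (2 * k)) * gaussianPDFReal 0 1 x := by ring
      _ ≤ _ := mul_le_of_le_one_left hp0.le hb
  set A : ℝ → ℝ := (Set.Ici T).indicator 1 with hA
  have hAm : Measurable A := measurable_one.indicator measurableSet_Ici
  have hA1 : ∀ x, |A x| ≤ 1 := fun x => by by_cases hx : T ≤ x <;> simp [hA, hx]
  have hAh : ∀ x, T ≤ x → A x + h x = 1 := fun x hx => by
    simp [hA, hx, hh0 x (hT.le.trans hx)]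
  have hg1 : ∀ x, |A x + h x| ≤ 1 := by
    intro x
    by_cases hx : T ≤ x
    · simp [hAh x hx]
    · simpa [hA, hx] using hh1 x
  refine ⟨fun x => A x + h x, hAm.add hhm, hg1, hAh,
    integral_mul_pow_eq_zero_of_U (hAm.add hhm) hg1 hR0 fun j hj => ?_⟩
  have hcomp : ∀ x : ℝ, (U ℝ j).eval (x / R + 1) =
      ((U ℝ j).comp (Polynomial.C R⁻¹ * X + 1)).eval x := fun x => by
    simp [div_eq_inv_mul]
  have hiA : Integrable (fun x => A x * (U ℝ j).eval (x / R + 1)) (gaussianReal 0 1) := by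
    simp_rw [hcomp]; exact integrable_mul_eval_gaussianReal hAm hA1 _
  have hih : Integrable (fun x => h x * (U ℝ j).eval (x / R + 1)) (gaussianReal 0 1) := by
    simp_rw [hcomp]; exact integrable_mul_eval_gaussianReal hhm hh1 _
  have hadd : ∀ x, (A + h) x * (U ℝ j).eval (x / R + 1) =
      A x * (U ℝ j).eval (x / R + 1) + h x * (U ℝ j).eval (x / R + 1) := fun x => add_mul _ _ _
  rw [integral_congr_ae (Filter.Eventually.of_forall hadd), integral_add hiA hih, integral_compensator_mul_U hR0 k c hj]
  have hAe : ∫ x, A x * (U ℝ j).eval (x / R + 1) ∂(gaussianReal 0 1) =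
      ∫ x in Set.Ici T, (U ℝ j).eval (x / R + 1) ∂(gaussianReal 0 1) := by
    rw [← integral_indicator measurableSet_Ici]
    refine integral_congr_ae (Filter.Eventually.of_forall fun x => ?_)
    by_cases hx : T ≤ x <;> simp [hA, hx]
  rw [hAe, hc]
  have hpi := Real.pi_pos
  field_simp
  ring

/-! ### Nearly orthogonal vectors from Reed–Solomon codes -/

theorem inner_sum_single {d q : ℕ} [NeZero q] (e : ZMod q × ZMod q ↪ Fin d) (P Q : ZMod q → ZMod q) :
    (inner ℝ (∑ a, EuclideanSpace.single (e (a, P a)) (1 : ℝ))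
      (∑ a, EuclideanSpace.single (e (a, Q a)) (1 : ℝ)) : ℝ) =
      (Finset.univ.filter fun a => P a = Q a).card := by
  simp_rw [sum_inner, inner_sum, EuclideanSpace.inner_single_left, PiLp.single_apply,
    e.injective.eq_iff, Prod.mk.injEq]
  rw [Finset.card_filter]
  push_cast
  refine Finset.sum_congr rfl fun a _ => ?_
  rw [Finset.sum_eq_single a]
  · simp
  · intro b _ hb; simp [hb.symm]
  · simp

theorem card_eval_eq_le {q m : ℕ} [Fact q.Prime] {P Q : Polynomial (ZMod q)} (hPQ : P ≠ Q)
    (hP : P ∈ Polynomial.degreeLT (ZMod q) m) (hQ : Q ∈ Polynomial.degreeLT (ZMod q) m) :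
    (Finset.univ.filter fun a => P.eval a = Q.eval a).card ≤ m := by
  have h0 : P - Q ≠ 0 := sub_ne_zero.2 hPQ
  have hd : (P - Q).natDegree < m :=
    (Polynomial.natDegree_lt_iff_degree_lt h0).2
      (Polynomial.mem_degreeLT.1 (Submodule.sub_mem _ hP hQ))
  refine le_trans ?_ ((Polynomial.card_roots' (P - Q)).trans hd.le)
  refine le_trans (Finset.card_le_card (t := (P - Q).roots.toFinset) fun a ha => ?_)
    (Multiset.toFinset_card_le _)
  simpa [h0, sub_eq_zero] using ha

/-- Each polynomial is encoded by the normalized indicator of its graph in `ZMod q × ZMod q`. Inner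
products count agreements, and distinct polynomials of degree below `m` agree at fewer than `m`
points. -/
theorem exists_reedSolomon_vectors {d q m : ℕ} (hq : q.Prime) (hm : m < q) (hd : q * q ≤ d) :
    ∃ V : Finset (Space d), (∀ v ∈ V, ‖v‖ = 1) ∧ V.card = q ^ m ∧
      ∀ u ∈ V, ∀ v ∈ V, u ≠ v → |(inner ℝ u v : ℝ)| ≤ m / q := by
  classical
  have : Fact q.Prime := ⟨hq⟩
  have hq0 : (0 : ℝ) < q := by exact_mod_cast hq.pos
  obtain ⟨e⟩ : Nonempty (ZMod q × ZMod q ↪ Fin d) :=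
    Function.Embedding.nonempty_of_card_le (by simpa [ZMod.card] using hd)
  let p : (Fin m → ZMod q) → Polynomial (ZMod q) := fun c =>
    ((Polynomial.degreeLTEquiv (ZMod q) m).symm c : Polynomial (ZMod q))
  have hp : ∀ c, p c ∈ Polynomial.degreeLT (ZMod q) m := fun c =>
    ((Polynomial.degreeLTEquiv (ZMod q) m).symm c).2
  have hpi : Function.Injective p :=
    Subtype.val_injective.comp (Polynomial.degreeLTEquiv (ZMod q) m).symm.injective
  let vec : (Fin m → ZMod q) → Space d := fun c =>
    (√(q : ℝ))⁻¹ • ∑ a, EuclideanSpace.single (e (a, (p c).eval a)) (1 : ℝ)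
  have hin : ∀ b c, (inner ℝ (vec b) (vec c) : ℝ) =
      (Finset.univ.filter fun a => (p b).eval a = (p c).eval a).card / q := by
    intro b c
    have hs : √(q : ℝ) * √q = q := Real.mul_self_sqrt hq0.le
    rw [real_inner_smul_left, real_inner_smul_right,
      inner_sum_single e (fun a => (p b).eval a) (fun a => (p c).eval a), ← mul_assoc,
      ← mul_inv, hs]
    ring
  have hnorm : ∀ c, ‖vec c‖ = 1 := by
    intro c
    have h := hin c c
    rw [real_inner_self_eq_norm_sq] at h
    have h1 : ‖vec c‖ ^ 2 = 1 := by
      rw [h]; simp [ZMod.card, hq0.ne']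
    exact (pow_eq_one_iff_of_nonneg (norm_nonneg _) two_ne_zero).1 h1
  have hlt : (m : ℝ) / q < 1 := by rw [div_lt_one hq0]; exact_mod_cast hm
  have hle : ∀ b c, b ≠ c → |(inner ℝ (vec b) (vec c) : ℝ)| ≤ m / q := by
    intro b c hbc
    rw [hin, abs_of_nonneg (by positivity)]
    gcongr
    exact_mod_cast card_eval_eq_le (hpi.ne hbc) (hp b) (hp c)
  have hinj : Function.Injective vec := by
    intro b c hbc
    by_contra hne
    have h := hle b c hne
    rw [hbc, real_inner_self_eq_norm_sq, hnorm] at h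
    norm_num at h; linarith
  refine ⟨Finset.univ.image vec, ?_, ?_, ?_⟩
  · simp only [Finset.mem_image, Finset.mem_univ, true_and]
    rintro _ ⟨c, rfl⟩
    exact hnorm c
  · rw [Finset.card_image_of_injective _ hinj]
    simp [ZMod.card]
  · simp only [Finset.mem_image, Finset.mem_univ, true_and]
    rintro _ ⟨b, rfl⟩ _ ⟨c, rfl⟩ hbc
    exact hle b c fun h => hbc (by rw [h])

/-- Exponentially many nearly orthogonal unit vectors. -/
theorem exists_nearly_orthogonal_family {d : ℕ} (hd : 2 ^ 24 ≤ d) :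
    ∃ V : Finset (Space d), (∀ v ∈ V, ‖v‖ = 1) ∧ (2 : ℝ) ^ ((d : ℝ) ^ (1 / 8 : ℝ)) ≤ V.card ∧
      ∀ u ∈ V, ∀ v ∈ V, u ≠ v → |(inner ℝ u v : ℝ)| ≤ 2 * (d : ℝ) ^ (-(1 / 4) : ℝ) := by
  set s := Nat.sqrt d with hs
  have hs1 : s * s ≤ d := Nat.sqrt_le d
  have hs2 : d < (s + 1) * (s + 1) := Nat.lt_succ_sqrt d
  have hs3 : 2 ^ 12 ≤ s := Nat.le_sqrt.2 (by norm_num; exact hd)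
  -- Bertrand's postulate gives a prime between `√d/2` and `√d`. With `m ≈ √q`, both `m/q =
  -- O(d^{-1/4})` and `m ≥ d^{1/8}` hold.
  obtain ⟨q, hq, hq1, hq2⟩ := Nat.exists_prime_lt_and_le_two_mul (s / 2) (by omega)
  set m := Nat.sqrt q with hm
  have hm1 : m * m ≤ q := Nat.sqrt_le q
  have hm2 : q < (m + 1) * (m + 1) := Nat.lt_succ_sqrt q
  have hqs : q ≤ s := by omega
  have hsq : s + 1 ≤ 2 * q := by omega
  have hm3 : 8 ≤ m := Nat.le_sqrt.2 (by omega)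
  have hmq : m < q := by nlinarith
  obtain ⟨V, hV1, hV2, hV3⟩ := exists_reedSolomon_vectors hq hmq
    ((Nat.mul_le_mul hqs hqs).trans hs1)
  have hd0 : (0 : ℝ) < d := by
    have : 0 < d := lt_of_lt_of_le (by norm_num) hd
    exact_mod_cast this
  set t := (d : ℝ) ^ (1 / 8 : ℝ) with ht
  have ht0 : 0 < t := by positivity
  have ht2 : (d : ℝ) ^ (1 / 4 : ℝ) = t ^ 2 := by
    rw [ht, ← Real.rpow_natCast, ← Real.rpow_mul hd0.le]; norm_num
  have ht8 : (d : ℝ) = t ^ 8 := by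
    rw [ht, ← Real.rpow_natCast, ← Real.rpow_mul hd0.le]; norm_num
  have ht4 : t ^ 4 ≤ 2 * q := by
    have h1 : (t ^ 4) ^ 2 ≤ ((2 * q : ℕ) : ℝ) ^ 2 := by
      rw [← pow_mul, ← ht8]
      have : d ≤ (2 * q) ^ 2 := by nlinarith
      exact_mod_cast this
    have := (pow_le_pow_iff_left₀ (by positivity) (by positivity) two_ne_zero).1 h1
    exact_mod_cast this
  have ht1 : 8 ≤ t := by
    have h1 : (8 : ℝ) ^ 8 ≤ t ^ 8 := by
      rw [← ht8]; exact_mod_cast (show 8 ^ 8 ≤ d from le_trans (by norm_num) hd)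
    exact (pow_le_pow_iff_left₀ (by norm_num) ht0.le (by norm_num)).1 h1
  have htm : t ^ 2 ≤ 2 * m := by
    have h1 : 2 * (q : ℝ) ≤ (2 * m) ^ 2 := by
      have : 2 * q ≤ (2 * m) ^ 2 := by nlinarith
      exact_mod_cast this
    have h2 : (t ^ 2) ^ 2 ≤ (2 * (m : ℝ)) ^ 2 := by
      rw [← pow_mul]; exact ht4.trans h1
    exact (pow_le_pow_iff_left₀ (by positivity) (by positivity) two_ne_zero).1 h2
  have hq0 : (0 : ℝ) < q := by exact_mod_cast hq.pos
  refine ⟨V, hV1, ?_, fun u hu v hv huv => (hV3 u hu v hv huv).trans ?_⟩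
  · rw [hV2]
    have htm' : t ≤ m := by nlinarith
    calc (2 : ℝ) ^ t ≤ 2 ^ (m : ℝ) := Real.rpow_le_rpow_of_exponent_le one_le_two htm'
      _ = 2 ^ m := Real.rpow_natCast _ _
      _ ≤ ((q ^ m : ℕ) : ℝ) := by
          push_cast; gcongr; exact_mod_cast hq.two_le
  · rw [Real.rpow_neg hd0.le, ht2, div_le_iff₀ hq0]
    have h1 : (m : ℝ) * m ≤ q := by exact_mod_cast hm1
    have hm0 : (0 : ℝ) < m := by exact_mod_cast (by omega : 0 < m)
    rw [mul_assoc, mul_comm, inv_mul_eq_div, div_mul_eq_mul_div, le_div_iff₀ (by positivity)]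
    nlinarith

/-! ### Labelled distributions and their correlations -/

theorem pi_absolutelyContinuous_pi {μ ν : Measure ℝ} [SigmaFinite μ] [SigmaFinite ν] (h : μ ≪ ν) :
    ∀ d : ℕ, Measure.pi (fun _ : Fin d => μ) ≪ Measure.pi (fun _ : Fin d => ν)
  | 0 => by rw [Measure.pi_of_empty, Measure.pi_of_empty]
  | d + 1 => by
    have hμ := (measurePreserving_piFinSuccAbove (fun _ : Fin (d + 1) => μ) 0).symm
    have hν := (measurePreserving_piFinSuccAbove (fun _ : Fin (d + 1) => ν) 0).symm
    rw [← hμ.map_eq, ← hν.map_eq]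
    exact (h.prod (pi_absolutelyContinuous_pi h d)).map (MeasurableEquiv.measurable _)

theorem stdGaussian_absolutelyContinuous (d : ℕ) :
    stdGaussian (Space d) ≪ (volume : Measure (Space d)) := by
  rw [← map_pi_eq_stdGaussian, ← (PiLp.volume_preserving_toLp (Fin d)).map_eq]
  exact (pi_absolutelyContinuous_pi (gaussianReal_absolutelyContinuous 0 one_ne_zero) d).map
    (by fun_prop)

instance : IsProbabilityMeasure uniformSign := ⟨by
  simp [uniformSign, ENNReal.inv_two_add_inv_two]⟩

instance (d : ℕ) : IsProbabilityMeasure (nullDistribution d) := by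
  unfold nullDistribution; infer_instance

instance (d : ℕ) : SigmaFinite (refMeasure d) := by
  unfold refMeasure; infer_instance

theorem nullDistribution_absolutelyContinuous (d : ℕ) : nullDistribution d ≪ refMeasure d := by
  refine (stdGaussian_absolutelyContinuous d).prod fun s hs => ?_
  rw [Measure.count_eq_zero_iff.1 hs, measure_empty]

@[fun_prop]
theorem measurable_units_val : Measurable (Units.val : ℤˣ → ℤ) :=
  comap_measurable _

@[fun_prop]
theorem measurable_int_cast_real : Measurable (Int.cast : ℤ → ℝ) :=
  measurable_from_top

instance : MeasurableSingletonClass ℤˣ where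
  measurableSet_singleton y := by
    have : ({y} : Set ℤˣ) = Units.val ⁻¹' {(y : ℤ)} := by ext z; simp [Units.ext_iff]
    rw [this]
    exact measurable_units_val (measurableSet_singleton _)

theorem abs_sign_coe (y : ℤˣ) : |((y : ℤ) : ℝ)| = 1 := by
  rcases Int.units_eq_one_or y with rfl | rfl <;> simp

theorem integral_nullDistribution {d : ℕ} {F : Example d → ℝ} (hF : Measurable F) {c : ℝ}
    (hc : ∀ p, |F p| ≤ c) :
    ∫ p, F p ∂(nullDistribution d) =
      ∫ x, (F (x, 1) + F (x, -1)) / 2 ∂(stdGaussian (Space d)) := by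
  have hi : Integrable F (nullDistribution d) :=
    Integrable.of_bound hF.aestronglyMeasurable c (Filter.Eventually.of_forall hc)
  rw [nullDistribution, integral_prod _ hi]
  refine integral_congr_ae (Filter.Eventually.of_forall fun x => ?_)
  have hy : ∀ y : ℤˣ, Integrable (fun z => F (x, z)) ((2⁻¹ : ℝ≥0∞) • Measure.dirac y) := fun y =>
    (Integrable.of_bound (Measurable.aestronglyMeasurable (by fun_prop)) c (Filter.Eventually.of_forall fun z => hc _)).smul_measure
      (by simp)
  simp only [uniformSign]
  rw [integral_add_measure (hy _) (hy _), integral_smul_measure, integral_smul_measure,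
    integral_dirac, integral_dirac]
  simp; ring

/-- The distribution of `(x, y)` with `x` standard Gaussian and `E[y | x] = f x`. -/
noncomputable def labelled {d : ℕ} (f : Space d → ℝ) : Measure (Example d) :=
  (nullDistribution d).withDensity fun p => ENNReal.ofReal (1 + ((p.2 : ℤ) : ℝ) * f p.1)

theorem sign_mul_mem {y : ℤˣ} {t : ℝ} (ht : |t| ≤ 1) :
    0 ≤ 1 + ((y : ℤ) : ℝ) * t ∧ 1 + ((y : ℤ) : ℝ) * t ≤ 2 := by
  have := abs_le.1 (show |((y : ℤ) : ℝ) * t| ≤ 1 by rw [abs_mul, abs_sign_coe, one_mul]; exact ht)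
  constructor <;> linarith

variable {d : ℕ} {f : Space d → ℝ}

theorem integral_labelled (hf : Measurable f) (hf1 : ∀ x, |f x| ≤ 1) {F : Example d → ℝ}
    (hF : Measurable F) {c : ℝ} (hc : ∀ p, |F p| ≤ c) :
    ∫ p, F p ∂(labelled f) =
      ∫ x, ((1 + f x) * F (x, 1) + (1 - f x) * F (x, -1)) / 2 ∂(stdGaussian (Space d)) := by
  rw [labelled, integral_withDensity_eq_integral_toReal_smul (by fun_prop) (by simp)]
  have h : ∀ p : Example d, (ENNReal.ofReal (1 + ((p.2 : ℤ) : ℝ) * f p.1)).toReal • F p =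
      (1 + ((p.2 : ℤ) : ℝ) * f p.1) * F p := fun p => by
    rw [ENNReal.toReal_ofReal (sign_mul_mem (hf1 _)).1, smul_eq_mul]
  simp_rw [h]
  rw [integral_nullDistribution (by fun_prop) (c := 2 * c) fun p => ?_]
  · refine integral_congr_ae (Filter.Eventually.of_forall fun x => ?_)
    simp only [Units.val_one, Units.val_neg, Int.cast_one, Int.cast_neg]; ring
  · rw [abs_mul, abs_of_nonneg (sign_mul_mem (hf1 _)).1]
    exact mul_le_mul (sign_mul_mem (hf1 _)).2 (hc p) (abs_nonneg _) (by norm_num)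

theorem isProbabilityMeasure_labelled (hf : Measurable f) (hf1 : ∀ x, |f x| ≤ 1) :
    IsProbabilityMeasure (labelled f) := by
  have hfin : IsFiniteMeasure (labelled f) := by
    refine isFiniteMeasure_withDensity_ofReal ?_
    refine (Integrable.of_bound (C := 2) (Measurable.aestronglyMeasurable (by fun_prop))
      (Filter.Eventually.of_forall fun p => ?_)).2
    rw [Real.norm_of_nonneg (sign_mul_mem (hf1 _)).1]
    exact (sign_mul_mem (hf1 _)).2
  have h := integral_labelled hf hf1 (F := fun _ => 1) (by fun_prop) (c := 1) (by simp)
  have h2 : ∀ x, ((1 + f x) * 1 + (1 - f x) * 1) / 2 = 1 := fun x => by ring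
  simp only [h2] at h
  simp only [integral_const, smul_eq_mul, mul_one, probReal_univ] at h
  exact isProbabilityMeasure_iff_real.2 h

theorem map_fst_labelled (hf : Measurable f) (hf1 : ∀ x, |f x| ≤ 1) :
    (labelled f).map Prod.fst = stdGaussian (Space d) := by
  have := isProbabilityMeasure_labelled hf hf1
  have : IsProbabilityMeasure ((labelled f).map Prod.fst) :=
    Measure.isProbabilityMeasure_map (by fun_prop)
  refine Measure.ext fun s hs => (measureReal_eq_measureReal_iff).1 ?_
  have h := integral_labelled hf hf1 (F := fun p => s.indicator 1 p.1)
    ((measurable_one.indicator hs).comp measurable_fst) (c := 1) (fun p => by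
      by_cases hp : p.1 ∈ s <;> simp [hp])
  have h2 : ∀ x, ((1 + f x) * s.indicator 1 x + (1 - f x) * s.indicator 1 x) / 2 =
      s.indicator 1 x := fun x => by ring
  simp only [h2] at h
  rw [integral_indicator_one hs, ← integral_map (f := s.indicator 1) (by fun_prop)
    (measurable_one.indicator hs).aestronglyMeasurable, integral_indicator_one hs] at h
  exact h

theorem isRegressionFunction_labelled (hf : Measurable f) (hf1 : ∀ x, |f x| ≤ 1) :
    IsRegressionFunction (labelled f) f := by
  have := isProbabilityMeasure_labelled hf hf1
  refine ⟨hf, ae_eq_condExp_of_forall_setIntegral_eq measurable_fst.comap_le ?_ ?_ ?_ ?_⟩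
  · exact Integrable.of_bound (Measurable.aestronglyMeasurable (by fun_prop)) 1
      (Filter.Eventually.of_forall fun p => (abs_sign_coe p.2).le)
  · exact fun s _ _ => (Integrable.of_bound (Measurable.aestronglyMeasurable (by fun_prop)) 1
      (Filter.Eventually.of_forall fun p => hf1 p.1)).integrableOn
  · rintro _ ⟨s, hs, rfl⟩ -
    have hs' : MeasurableSet (Prod.fst ⁻¹' s : Set (Example d)) := measurable_fst hs
    rw [← integral_indicator hs', ← integral_indicator hs',
      integral_labelled hf hf1 (Measurable.indicator (by fun_prop) hs') (c := 1) ?_,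
      integral_labelled hf hf1 (Measurable.indicator (by fun_prop) hs') (c := 1) ?_]
    · refine integral_congr_ae (Filter.Eventually.of_forall fun x => ?_)
      by_cases hx : x ∈ s <;> simp [Set.indicator, hx]; ring
    · intro p; by_cases hp : p.1 ∈ s <;> simp [Set.indicator, hp, abs_sign_coe]
    · intro p; by_cases hp : p.1 ∈ s <;> simp [Set.indicator, hp, hf1]
  · exact (hf.comp (comap_measurable Prod.fst)).aestronglyMeasurable

theorem labelled_absolutelyContinuous (f : Space d → ℝ) : labelled f ≪ nullDistribution d :=
  withDensity_absolutelyContinuous _ _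

theorem density_labelled (hf : Measurable f) (hf1 : ∀ x, |f x| ≤ 1) :
    density (labelled f) =ᵐ[refMeasure d]
      fun p => (1 + ((p.2 : ℤ) : ℝ) * f p.1) * density (nullDistribution d) p := by
  have h := Measure.rnDeriv_withDensity_left (μ := nullDistribution d) (ν := refMeasure d)
    (f := fun p => ENNReal.ofReal (1 + ((p.2 : ℤ) : ℝ) * f p.1)) (Measurable.aemeasurable (by fun_prop)) (by simp)
  filter_upwards [h] with p hp
  rw [density, labelled, hp, ENNReal.toReal_mul, ENNReal.toReal_ofReal (sign_mul_mem (hf1 _)).1,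
    density]

theorem correlationIntegrand_labelled {f' : Space d → ℝ} (hf : Measurable f)
    (hf1 : ∀ x, |f x| ≤ 1) (hf' : Measurable f') (hf1' : ∀ x, |f' x| ≤ 1) :
    correlationIntegrand (nullDistribution d) (labelled f) (labelled f') =ᵐ[refMeasure d]
      fun p => ((nullDistribution d).rnDeriv (refMeasure d) p).toReal •
        ((1 + ((p.2 : ℤ) : ℝ) * f p.1) * (1 + ((p.2 : ℤ) : ℝ) * f' p.1)) := by
  filter_upwards [density_labelled hf hf1, density_labelled hf' hf1'] with p h1 h2
  rw [correlationIntegrand, h1, h2, smul_eq_mul]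
  change _ = density (nullDistribution d) p * _
  -- Where the null density vanishes, the quotient is `0 / 0 = 0`, as needed.
  by_cases h0 : density (nullDistribution d) p = 0
  · simp [h0]
  · field_simp

theorem correlationDefined_labelled {f' : Space d → ℝ} (hf : Measurable f)
    (hf1 : ∀ x, |f x| ≤ 1) (hf' : Measurable f') (hf1' : ∀ x, |f' x| ≤ 1) :
    CorrelationDefined (nullDistribution d) (labelled f) (labelled f') where
  hasDensity := nullDistribution_absolutelyContinuous d
  hasDensity₁ := (labelled_absolutelyContinuous f).trans (nullDistribution_absolutelyContinuous d)
  hasDensity₂ := (labelled_absolutelyContinuous f').trans (nullDistribution_absolutelyContinuous d)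
  dominated₁ := labelled_absolutelyContinuous f
  dominated₂ := labelled_absolutelyContinuous f'
  integrable := by
    rw [integrable_congr (correlationIntegrand_labelled hf hf1 hf' hf1'),
      integrable_rnDeriv_smul_iff (nullDistribution_absolutelyContinuous d)]
    refine Integrable.of_bound (C := 2 * 2) (Measurable.aestronglyMeasurable (by fun_prop)) (Filter.Eventually.of_forall fun p => ?_)
    rw [norm_mul, Real.norm_of_nonneg (sign_mul_mem (hf1 _)).1,
      Real.norm_of_nonneg (sign_mul_mem (hf1' _)).1]
    exact mul_le_mul (sign_mul_mem (hf1 _)).2 (sign_mul_mem (hf1' _)).2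
      (sign_mul_mem (hf1' _)).1 (by norm_num)

/-- Averaging `(1 + y f)(1 + y f')` over the uniform sign kills the linear terms and leaves `1 + f
f'`. -/
theorem pairwiseCorrelation_labelled {f' : Space d → ℝ} (hf : Measurable f)
    (hf1 : ∀ x, |f x| ≤ 1) (hf' : Measurable f') (hf1' : ∀ x, |f' x| ≤ 1) :
    pairwiseCorrelation (nullDistribution d) (labelled f) (labelled f') =
      ∫ x, f x * f' x ∂(stdGaussian (Space d)) := by
  have hi : Integrable (fun x => f x * f' x) (stdGaussian (Space d)) := by
    refine Integrable.of_bound (C := 1) (Measurable.aestronglyMeasurable (by fun_prop)) (Filter.Eventually.of_forall fun x => ?_)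
    rw [norm_mul]
    exact mul_le_one₀ (hf1 x) (norm_nonneg _) (hf1' x)
  rw [pairwiseCorrelation, integral_congr_ae (correlationIntegrand_labelled hf hf1 hf' hf1'),
    integral_rnDeriv_smul (nullDistribution_absolutelyContinuous d),
    integral_nullDistribution (by fun_prop) (c := 2 * 2) fun p => ?_]
  · have h : ∀ x, ((1 + (((1 : ℤˣ) : ℤ) : ℝ) * f x) * (1 + (((1 : ℤˣ) : ℤ) : ℝ) * f' x) +
        (1 + (((-1 : ℤˣ) : ℤ) : ℝ) * f x) * (1 + (((-1 : ℤˣ) : ℤ) : ℝ) * f' x)) / 2 =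
        1 + f x * f' x := fun x => by simp; ring
    simp_rw [h]
    rw [integral_add (integrable_const _) hi]
    simp
  · rw [abs_mul, abs_of_nonneg (sign_mul_mem (hf1 _)).1, abs_of_nonneg (sign_mul_mem (hf1' _)).1]
    exact mul_le_mul (sign_mul_mem (hf1 _)).2 (sign_mul_mem (hf1' _)).2
      (sign_mul_mem (hf1' _)).1 (by norm_num)

/-! ### Gaussian quantiles and the choice of `k` -/

theorem gaussianReal_Ici_stdNormalQuantile_le {α : ℝ} (h0 : 0 < α) (h1 : α < 1) :
    (gaussianReal 0 1).real (Set.Ici (stdNormalQuantile (1 - α))) ≤ α := by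
  set S := {t : ℝ | 1 - α ≤ stdNormalCDF t} with hS
  have hne : S.Nonempty := by
    have h := (tendsto_cdf_atTop (gaussianReal 0 1)).eventually_const_le (show 1 - α < 1 by linarith)
    exact h.exists
  have hbdd : BddBelow S := by
    have h := (tendsto_cdf_atBot (gaussianReal 0 1)).eventually_lt_const (show 0 < 1 - α by linarith)
    obtain ⟨b, hb⟩ := h.exists
    refine ⟨b, fun t ht => ?_⟩
    by_contra! hlt
    have := monotone_cdf (gaussianReal 0 1) hlt.le
    simp only [hS, Set.mem_ofPred_eq, stdNormalCDF] at ht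
    linarith
  -- Right continuity of the distribution function makes the infimum attained.
  have hmem : 1 - α ≤ stdNormalCDF (sInf S) := by
    refine ge_of_tendsto ((cdf (gaussianReal 0 1)).right_continuous (sInf S) |>.mono_left
      (nhdsWithin_mono _ Set.Ioi_subset_Ici_self)) ?_
    filter_upwards [self_mem_nhdsWithin] with t ht
    obtain ⟨s, hs, hst⟩ := exists_lt_of_csInf_lt hne ht
    exact le_trans hs (monotone_cdf (gaussianReal 0 1) hst.le)
  change (gaussianReal 0 1).real (Set.Ici (sInf S)) ≤ α
  have hna := nullSingletonClass_gaussianReal (μ := 0) (v := 1) one_ne_zero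
  rw [measureReal_congr (Ioi_ae_eq_Ici (μ := gaussianReal 0 1)).symm, ← Set.compl_Iic,
    measureReal_compl measurableSet_Iic, probReal_univ]
  rw [stdNormalCDF, cdf_eq_real] at hmem
  linarith

theorem gaussianReal_Ici_zero : (gaussianReal 0 1).real (Set.Ici 0) = 1 / 2 := by
  have hna := nullSingletonClass_gaussianReal (μ := 0) (v := 1) one_ne_zero
  have h1 : (gaussianReal 0 1).real (Set.Iic 0) = (gaussianReal 0 1).real (Set.Ici 0) := by
    have h := gaussianReal_map_neg (μ := 0) (v := 1)
    rw [neg_zero] at h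
    conv_lhs => rw [← h]
    rw [map_measureReal_apply (by fun_prop) measurableSet_Iic]
    congr 1; ext x; simp
  have h2 := probReal_compl_eq_one_sub (μ := gaussianReal 0 1) (measurableSet_Iic (a := (0 : ℝ)))
  rw [Set.compl_Iic, measureReal_congr (Ioi_ae_eq_Ici (μ := gaussianReal 0 1)), h1] at h2
  linarith

theorem stdNormalQuantile_pos {α : ℝ} (h0 : 0 < α) (h1 : α < 1 / 2) :
    0 < stdNormalQuantile (1 - α) := by
  by_contra! h
  have h2 := gaussianReal_Ici_stdNormalQuantile_le h0 (by linarith)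
  have h3 : (gaussianReal 0 1).real (Set.Ici 0) ≤
      (gaussianReal 0 1).real (Set.Ici (stdNormalQuantile (1 - α))) :=
    measureReal_mono (Set.Ici_subset_Ici.2 h)
  rw [gaussianReal_Ici_zero] at h3
  linarith

theorem exists_threshold_function {α : ℝ} (h0 : 0 < α) (h1 : α ≤ Real.exp (-12)) :
    ∃ (k : ℕ) (g : ℝ → ℝ), 1 ≤ k ∧ Real.log (1 / α) / 24 ≤ k ∧ Measurable g ∧ (∀ x, |g x| ≤ 1) ∧
      (∀ x, stdNormalQuantile (1 - α) ≤ x → g x = 1) ∧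
      ∀ n < k, ∫ x, g x * x ^ n ∂(gaussianReal 0 1) = 0 := by
  have hα : α < 1 / 2 := by
    have e := Real.add_one_le_exp 12
    have : Real.exp (-12) ≤ 1 / 13 := by
      rw [Real.exp_neg, inv_le_comm₀ (by positivity) (by norm_num)]; linarith
    linarith
  set l := Real.log (1 / α) with hl
  have hl' : l = -Real.log α := by rw [hl, one_div, Real.log_inv]
  have hl12 : 12 ≤ l := by
    have := Real.log_le_log h0 h1
    rw [Real.log_exp] at this; linarith
  -- `k = ⌊l/12⌋` makes `e^{6k} √α = e^{6k - l/2} ≤ 1`. Since `l ≥ 12`, rounding loses at most a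
  -- factor 2, whence `l/24`.
  have hf := Nat.floor_le (show 0 ≤ l / 12 by linarith)
  have hf' := Nat.lt_floor_add_one (l / 12)
  have hk : 1 ≤ ⌊l / 12⌋₊ := Nat.le_floor (by push_cast; linarith)
  have hk' : (1 : ℝ) ≤ ⌊l / 12⌋₊ := by exact_mod_cast hk
  have hβ : Real.exp (6 * ⌊l / 12⌋₊) * √α ≤ 1 := by
    have e : √α = Real.exp (-l / 2) := by
      rw [hl', neg_neg, Real.exp_half, Real.exp_log h0]
    rw [e, ← Real.exp_add, Real.exp_le_one_iff]
    linarith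
  obtain ⟨g, hg⟩ := exists_bounded_orthogonal hk (stdNormalQuantile_pos h0 hα)
    (Real.sqrt_pos.2 h0) hβ ((Real.sq_sqrt h0.le).symm ▸
      gaussianReal_Ici_stdNormalQuantile_le h0 (by linarith))
  exact ⟨_, g, hk, by linarith, hg⟩

end ReliableHalfspace

/-! ### Assembly and constants -/

theorem mainTheorem5 :
    ∃ (α₀ : ℝ) (C : ℝ) (c₁ : ℝ) (c₂ : ℝ) (d₀ : ℕ), 0 < α₀ ∧ 0 < C ∧ 0 < c₁ ∧ 0 < c₂ ∧
      ∀ α : ℝ, 0 < α → α ≤ α₀ → ∀ d : ℕ, d₀ ≤ d →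
        ∃ (V : Finset (ReliableHalfspace.Space d))
          (D : ReliableHalfspace.Space d → Measure (ReliableHalfspace.Example d)),
          (∀ v ∈ V, ‖v‖ = 1) ∧
          (∀ v ∈ V, IsProbabilityMeasure (D v)) ∧
          Set.InjOn D (V : Set (ReliableHalfspace.Space d)) ∧
          (2 : ℝ) ^ ((d : ℝ) ^ c₁) ≤ (V.card : ℝ) ∧
          (∀ v ∈ V, (D v).map Prod.fst = stdGaussian (ReliableHalfspace.Space d)) ∧
          (∀ v ∈ V, ∃ f : ReliableHalfspace.Space d → ℝ,
            ReliableHalfspace.IsRegressionFunction (D v) f ∧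
            ∀ x : ReliableHalfspace.Space d,
              ReliableHalfspace.stdNormalQuantile (1 - α) ≤ inner ℝ v x → f x = 1) ∧
          (∀ u ∈ V, ∀ v ∈ V,
            ReliableHalfspace.CorrelationDefined
              (ReliableHalfspace.nullDistribution d) (D u) (D v) ∧
            (u = v → |ReliableHalfspace.pairwiseCorrelation
              (ReliableHalfspace.nullDistribution d) (D u) (D v)| ≤ C) ∧
            (u ≠ v → |ReliableHalfspace.pairwiseCorrelation
              (ReliableHalfspace.nullDistribution d) (D u) (D v)| ≤
                (d : ℝ) ^ (-(c₂ * Real.log (1 / α))))) := by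
  -- `α ≤ e^{-12}` gives `k ≥ 1`. `d ≥ 2^72` gives `d^{1/8} ≥ 2^9 ≥ 288 = 2 * 144`, so `144|ρ| ≤
  -- d^{-1/8}`. Finally `1/192 = 1/8 * 1/24`.
  refine ⟨Real.exp (-12), 1, 1 / 8, 1 / 192, 2 ^ 72, Real.exp_pos _, one_pos, by norm_num,
    by norm_num, fun α hα hα1 d hd => ?_⟩
  obtain ⟨k, g, hk, hlk, hm, hg, hgT, horth⟩ :=
    ReliableHalfspace.exists_threshold_function hα hα1
  obtain ⟨V, hV1, hVc, hVi⟩ := ReliableHalfspace.exists_nearly_orthogonal_family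
    (le_trans (by norm_num) hd)
  have hd1 : (1 : ℝ) ≤ d := by
    exact_mod_cast le_trans (show 1 ≤ 2 ^ 72 by norm_num) hd
  have hd0 : (0 : ℝ) < d := by linarith
  have hd8 : 288 * (d : ℝ) ^ (-(1 / 4) : ℝ) ≤ (d : ℝ) ^ (-(1 / 8) : ℝ) := by
    have h1 : (288 : ℝ) ≤ (d : ℝ) ^ (1 / 8 : ℝ) := by
      calc (288 : ℝ) ≤ 2 ^ 9 := by norm_num
        _ = ((2 : ℝ) ^ 72) ^ (1 / 8 : ℝ) := by
            rw [← Real.rpow_natCast, ← Real.rpow_natCast, ← Real.rpow_mul (by norm_num)]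
            norm_num
        _ ≤ (d : ℝ) ^ (1 / 8 : ℝ) := by
            gcongr
            exact_mod_cast hd
    calc 288 * (d : ℝ) ^ (-(1 / 4) : ℝ) ≤ (d : ℝ) ^ (1 / 8 : ℝ) * (d : ℝ) ^ (-(1 / 4) : ℝ) := by
          gcongr
      _ = _ := by rw [← Real.rpow_add hd0]; norm_num
  have hd8' : (d : ℝ) ^ (-(1 / 8) : ℝ) ≤ 1 := Real.rpow_le_one_of_one_le_of_nonpos hd1 (by norm_num)
  have hfm : ∀ v : ReliableHalfspace.Space d, Measurable fun x => g (inner ℝ v x) :=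
    fun v => by fun_prop
  have hf1 : ∀ v x : ReliableHalfspace.Space d, |g (inner ℝ v x)| ≤ 1 := fun v x => hg _
  have hreg := fun v => ReliableHalfspace.isRegressionFunction_labelled (hfm v) (hf1 v)
  have hmap := fun v => ReliableHalfspace.map_fst_labelled (hfm v) (hf1 v)
  have hinner : ∀ u ∈ V, ∀ v ∈ V, u ≠ v → 144 * |(inner ℝ u v : ℝ)| ≤ (d : ℝ) ^ (-(1 / 8) : ℝ) :=
    fun u hu v hv huv => by linarith [hVi u hu v hv huv]
  refine ⟨V, fun v => ReliableHalfspace.labelled fun x => g (inner ℝ v x), hV1,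
    fun v _ => ReliableHalfspace.isProbabilityMeasure_labelled (hfm v) (hf1 v), ?_, hVc,
    fun v _ => hmap v, fun v _ => ⟨_, hreg v, fun x hx => hgT _ hx⟩, fun u hu v hv =>
    ⟨ReliableHalfspace.correlationDefined_labelled (hfm u) (hf1 u) (hfm v) (hf1 v), ?_, ?_⟩⟩
  -- Equal distributions share their conditional expectation, so their ridge functions would agree
  -- almost everywhere.
  · intro u hu v hv huv
    by_contra hne
    have hae := (hreg u).ae_eq
    rw [show ReliableHalfspace.labelled (fun x => g (inner ℝ u x)) =
      ReliableHalfspace.labelled (fun x => g (inner ℝ v x)) from huv] at hae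
    have hae' := hae.trans (hreg v).ae_eq.symm
    refine ReliableHalfspace.not_ridge_ae_eq_ridge (hV1 u hu) (hV1 v hv)
      (by linarith [hinner u hu v hv hne]) hm hgT (by simpa using horth 0 hk) ?_
    rw [← hmap v]
    exact (ae_map_iff (by fun_prop) (measurableSet_eq_fun (hfm u) (hfm v))).2 hae'
  · intro _
    rw [ReliableHalfspace.pairwiseCorrelation_labelled (hfm u) (hf1 u) (hfm v) (hf1 v)]
    rw [← Real.norm_eq_abs]
    refine (norm_integral_le_of_norm_le_const (C := 1) (Filter.Eventually.of_forall fun x => ?_)).trans_eq (by rw [probReal_univ, one_mul])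
    rw [norm_mul]
    exact mul_le_one₀ (hf1 u x) (norm_nonneg _) (hf1 v x)
  · intro hne
    have hi := hinner u hu v hv hne
    rw [ReliableHalfspace.pairwiseCorrelation_labelled (hfm u) (hf1 u) (hfm v) (hf1 v)]
    calc _ ≤ (144 * |(inner ℝ u v : ℝ)|) ^ k :=
          ReliableHalfspace.abs_integral_ridge_mul_ridge_le (hV1 u hu) (hV1 v hv) (by linarith)
            hm hg hk horth
      _ ≤ ((d : ℝ) ^ (-(1 / 8) : ℝ)) ^ k := by gcongr
      _ = (d : ℝ) ^ (-(1 / 8) * k : ℝ) := by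
          rw [← Real.rpow_natCast, ← Real.rpow_mul hd0.le]
      _ ≤ _ := Real.rpow_le_rpow_of_exponent_le hd1 (by linarith)
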